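/- **Setting.** Let $S$ be a compact connected orientable surface of genus $g$ with $b\ge 1$ boundary components, drawn in the plane as follows. If $g=0$, $S$ is the closed unit disk with $b-1$ disjoint open round disks removed (with disjoint closures inside the open unit disk). If $g>0$, $S$ is a punctured fundamental polygon: a regular $4g$-gon with $b$ such disks removed from its interior, whose sides are glued in pairs, reversing their counterclockwise directions, so that all corners become one point. A *directed network* $N=(V,E)$ on $S$ is a finite directed graph embedded in $S$; its edges are smooth curves with nowhere zero derivative, whose points other than their endpoints are interior points of $S$. Vertices do not lie on the sides of the polygon, edges cross the sides transversally and not at the corners, edges are not tangent to $\partial S$, and an edge entering a vertex and an edge leaving it do not form a cusp there. Let $K\subseteq V$ be the set of vertices on $\partial S$ and $I\subseteq K$ the set of those that are sources. $N$ is *perfectly oriented* if every $v\in K$ is a univalent source or sink and every $v\in V\setminus K$ is trivalent and neither a source nor a sink. Choose $b-1$ disjoint smooth simple cuts in $S$ between pairs of distinct boundary components, such that the cut surface $T$ has a single boundary component. The cuts avoid the vertices of $N$ and are transversal to the edges, to $\partial S$ and to the sides of the polygon (whose corners they avoid). Choose a piecewise smooth parameterization $\phi:[0,1]\to\partial T$,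 with $\phi(0)=\phi(1)$, running once around $\partial T$ in either direction. It orders $K$ linearly: $i<j$ if $\phi$ reaches $i$ before $j$. For $i\in I$, $j\in K$ let $s_{ij}$ be the number of elements of $I$ strictly between $i$ and $j$. A path $P:i\rightsquigarrow j$ is a finite sequence of consecutive directed edges leading from $i$ to $j$ (the empty path is allowed if $i=j$). For $i\in I$, $j\in K$ and $P:i\rightsquigarrow j$ let $C(P)$ be the closed curve in the plane that follows $P$ from $i$ to $j$ and then $\partial T$, in the direction of $\phi$, from $j$ to $i$ (once around if $i=j$); each time it leaves the polygon through a side, the exit point is connected to the entry point by following the sides of the polygon clockwise. Let $r_P\in\mathbb Z$ be the rotation number of $C(P)$, that is, the degree of its unit tangent vector after smoothing the corners: $\frac1{2\pi}$ times the total turning of the tangent along the smooth pieces plus the exterior angles at the corners. For edge weights $\{y_e\}_{e\in E}$ put $\operatorname{wt}_y(P)=\prod_{e\in P}y_e$ (a product over the edges of $P$ with multiplicity). In the ring $\mathbb R[[x_e:e\in E]]$ of formal power series define the $I\times K$ matrices $$A(N,\{y_e\})_{ij}=\sum_{P:i\rightsquigarrow j}\operatorname{wt}_y(P),\qquad B(N,\{y_e\})_{ij}=\sum_{P:i\rightsquigarrow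 j}(-1)^{s_{ij}+r_P+1}\operatorname{wt}_y(P).$$ $A$ is the weighted path matrix restricted to the rows $I$ and columns $K$, and $B$ is the boundary measurement matrix. **Theorem.** If $N=(V,E)$ is a perfectly oriented network embedded on a compact connected orientable surface with nonempty boundary then, for every choice of the planar drawing, of the cuts and of $\phi$ as above, there is a collection $\{\epsilon_e\}_{e\in E}\in\{\pm1\}^E$ such that $$B(N,\{x_e\}_{e\in E})=A(N,\{\epsilon_e x_e\}_{e\in E}).$$ -/

import Mathlib

open Set
open scoped ContDiff ComplexConjugate MvPowerSeries.WithPiTopology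

noncomputable section

/-! ### Smooth arcs in the plane and rotation numbers of closed curves -/

/-- A smooth arc in the plane `ℂ = ℝ²`, parameterized by `[0,1]` with nowhere zero derivative.
(The parameterization is recorded as a smooth function on `ℝ`; only `[0,1]` is used.) -/
structure PlanarArc where
  toFun : ℝ → ℂ
  smooth : ContDiff ℝ ∞ toFun
  regular : ∀ t ∈ Icc (0 : ℝ) 1, deriv toFun t ≠ 0

namespace PlanarArc

/-- Velocity at time `t`. -/
def vel (γ : PlanarArc) (t : ℝ) : ℂ := deriv γ.toFun t

def start (γ : PlanarArc) : ℂ := γ.toFun 0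

def finish (γ : PlanarArc) : ℂ := γ.toFun 1

/-- The same arc traversed backwards. -/
def reverse (γ : PlanarArc) : PlanarArc where
  toFun t := γ.toFun (1 - t)
  smooth := γ.smooth.comp (contDiff_const.sub contDiff_id)
  regular t ht := by
    rw [deriv_comp_const_sub]
    exact neg_ne_zero.mpr (γ.regular _ ⟨by linarith [ht.2], by linarith [ht.1]⟩)

/-- The direction of the tangent vector has a continuous angle along the arc. -/
theorem exists_angle (γ : PlanarArc) : ∃ θ : ℝ → ℝ, ContinuousOn θ (Icc 0 1) ∧
    ∀ t ∈ Icc (0 : ℝ) 1, γ.vel t = (‖γ.vel t‖ : ℂ) * Complex.exp (θ t * Complex.I) := by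
  have hc : Continuous γ.vel := γ.smooth.continuous_deriv (by simp)
  have hne : ∀ t : unitInterval, γ.vel t ≠ 0 := fun t => γ.regular t t.2
  let f : C(unitInterval, Circle) :=
    ⟨fun t => ⟨γ.vel t / (‖γ.vel t‖ : ℂ), by
        rw [Submonoid.unitSphere, Submonoid.mem_mk]
        simp [hne t]⟩, by
      refine Continuous.subtype_mk ?_ _
      refine Continuous.div (hc.comp continuous_subtype_val) ?_ ?_
      · exact Complex.continuous_ofReal.comp (hc.comp continuous_subtype_val).norm
      · intro t
        simpa using hne t⟩
  have h0 : f 0 = Circle.exp (Complex.arg (f 0)) := (Circle.exp_arg (f 0)).symm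
  let Γ := Circle.isCoveringMap_exp.liftPath f (Complex.arg (f 0)) h0
  have hΓ := Circle.isCoveringMap_exp.liftPath_lifts f (Complex.arg (f 0)) h0
  refine ⟨Set.IccExtend (zero_le_one) Γ, (Γ.continuous.Icc_extend').continuousOn, ?_⟩
  intro t ht
  rw [Set.IccExtend_of_mem _ _ ht]
  have h1 := congrArg (fun z : Circle => (z : ℂ)) (congrFun hΓ ⟨t, ht⟩)
  simp only [Function.comp_apply, Circle.coe_exp] at h1
  change Complex.exp ((Γ ⟨t, ht⟩ : ℝ) * Complex.I) = γ.vel t / (‖γ.vel t‖ : ℂ) at h1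
  rw [h1]
  have : (‖γ.vel t‖ : ℂ) ≠ 0 := by simpa using hne ⟨t, ht⟩
  field_simp

/-- The total angle by which the tangent vector turns along the arc. -/
def turning (γ : PlanarArc) : ℝ := γ.exists_angle.choose 1 - γ.exists_angle.choose 0

/-- The exterior angle in `(-π, π]` at a corner where `γ` is followed by `δ`: the angle by which
the tangent vector turns when the corner is smoothed. -/
def extAngle (γ δ : PlanarArc) : ℝ := Complex.arg (δ.vel 0 / γ.vel 1)

/-- Total turning of the tangent vector along the piecewise smooth closed curve formed by a
cyclic sequence of arcs. -/
def totalTurning (l : List PlanarArc) : ℝ :=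
  (l.map turning).sum + (List.zipWith extAngle l (l.rotate 1)).sum

theorem exp_turning (γ : PlanarArc) :
    Complex.exp (γ.turning * Complex.I) =
      (γ.vel 1 / (‖γ.vel 1‖ : ℂ)) / (γ.vel 0 / (‖γ.vel 0‖ : ℂ)) := by
  obtain ⟨-, h⟩ := γ.exists_angle.choose_spec
  have h0 := h 0 (by simp)
  have h1 := h 1 (by simp)
  have n0 : (‖γ.vel 0‖ : ℂ) ≠ 0 := by simpa [vel] using γ.regular 0 (by simp)
  have n1 : (‖γ.vel 1‖ : ℂ) ≠ 0 := by simpa [vel] using γ.regular 1 (by simp)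
  rw [turning]
  push_cast
  rw [sub_mul, Complex.exp_sub]
  congr 1
  · rw [eq_div_iff n1, mul_comm]; exact h1.symm
  · rw [eq_div_iff n0, mul_comm]; exact h0.symm

theorem exp_extAngle (γ δ : PlanarArc) :
    Complex.exp (extAngle γ δ * Complex.I) =
      (δ.vel 0 / (‖δ.vel 0‖ : ℂ)) / (γ.vel 1 / (‖γ.vel 1‖ : ℂ)) := by
  have d0 : δ.vel 0 ≠ 0 := δ.regular 0 (by simp)
  have g1 : γ.vel 1 ≠ 0 := γ.regular 1 (by simp)
  have n0 : (‖δ.vel 0‖ : ℂ) ≠ 0 := by simpa using d0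
  have n1 : (‖γ.vel 1‖ : ℂ) ≠ 0 := by simpa using g1
  have h := Complex.norm_mul_exp_arg_mul_I (δ.vel 0 / γ.vel 1)
  rw [norm_div] at h
  push_cast at h
  rw [extAngle]
  field_simp
  field_simp at h
  linear_combination h

theorem exp_sum_turning (l : List PlanarArc) :
    Complex.exp (((l.map turning).sum : ℝ) * Complex.I) =
      (l.map fun γ => γ.vel 1 / (‖γ.vel 1‖ : ℂ)).prod /
        (l.map fun γ => γ.vel 0 / (‖γ.vel 0‖ : ℂ)).prod := by
  induction l with
  | nil => simp
  | cons a l ih =>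
    simp only [List.map_cons, List.sum_cons, List.prod_cons]
    push_cast at ih ⊢
    rw [add_mul, Complex.exp_add, ih, exp_turning, div_mul_div_comm]

theorem exp_sum_extAngle (l m : List PlanarArc) (h : l.length = m.length) :
    Complex.exp (((List.zipWith extAngle l m).sum : ℝ) * Complex.I) =
      (m.map fun γ => γ.vel 0 / (‖γ.vel 0‖ : ℂ)).prod /
        (l.map fun γ => γ.vel 1 / (‖γ.vel 1‖ : ℂ)).prod := by
  induction l generalizing m with
  | nil =>
    obtain rfl : m = [] := by simpa using h.symm
    simp
  | cons a l ih =>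
    cases m with
    | nil => simp at h
    | cons b m =>
      simp only [List.zipWith_cons_cons, List.map_cons, List.sum_cons, List.prod_cons]
      have ih' := ih m (by simpa using h)
      push_cast at ih' ⊢
      rw [add_mul, Complex.exp_add, ih', exp_extAngle, div_mul_div_comm]

theorem exists_rotationNumber (l : List PlanarArc) :
    ∃ r : ℤ, totalTurning l = 2 * Real.pi * r := by
  have hu : ∀ t ∈ Icc (0 : ℝ) 1, (l.map fun γ => γ.vel t / (‖γ.vel t‖ : ℂ)).prod ≠ 0 := by
    intro t ht
    apply List.prod_ne_zero
    simp only [List.mem_map, not_exists, not_and]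
    intro γ _ h0
    have hne : γ.vel t ≠ 0 := γ.regular t ht
    simp [hne] at h0
  have h : Complex.exp ((totalTurning l : ℝ) * Complex.I) = 1 := by
    rw [totalTurning, Complex.ofReal_add, add_mul, Complex.exp_add, exp_sum_turning,
      exp_sum_extAngle l (l.rotate 1) (by simp),
      ((l.rotate_perm 1).map _).prod_eq]
    have h0 := hu 0 (by simp)
    have h1 := hu 1 (by simp)
    field_simp
  obtain ⟨n, hn⟩ := Complex.exp_eq_one_iff.mp h
  refine ⟨n, ?_⟩
  have h2 : (totalTurning l : ℂ) = n * (2 * Real.pi) := by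
    apply mul_right_cancel₀ Complex.I_ne_zero
    rw [hn]; ring
  have h3 : totalTurning l = n * (2 * Real.pi) := by exact_mod_cast h2
  rw [h3]; ring

/-- The rotation number of the piecewise smooth closed curve formed by a cyclic sequence of arcs:
the degree of its unit tangent vector, after smoothing the corners. -/
def rotationNumber (l : List PlanarArc) : ℤ := (exists_rotationNumber l).choose

end PlanarArc

/-! ### Surfaces, drawn in the plane -/

/-- The vertex with number `k` (mod `4g`) of the regular `4g`-gon inscribed in the unit circle,
in counterclockwise order. -/
def polygonCorner (g : ℕ) (k : ℤ) : ℂ := Complex.exp (2 * Real.pi * Complex.I * k / (4 * g))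

/-- The point with parameter `a ∈ [0,1]` on the side from corner `k` to corner `k + 1`. -/
def sidePoint (g : ℕ) (k : ℤ) (a : ℝ) : ℂ :=
  polygonCorner g k + a * (polygonCorner g (k + 1) - polygonCorner g k)

/-- The open disk (genus `0`) or open `4g`-gon (genus `g > 0`) inside which the surface is drawn. -/
def openFace (g : ℕ) : Set ℂ :=
  if g = 0 then Metric.ball 0 1 else interior (convexHull ℝ (range (polygonCorner g)))

/-- A compact connected orientable surface with nonempty boundary, given in the plane. In genus `0`
it is the closed unit disk with some open round disks removed (the unit circle being
the external boundary component). In genus `g > 0` it is the punctured fundamental polygon: a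
`4g`-gon with some open round disks removed, with side `s` glued to side `pair s` reversing
their counterclockwise directions. All corners of the polygon are the same point of the
surface, so that the sides are `2g` loops generating the homology of the closed surface. -/
structure PuncturedPolygon where
  genus : ℕ
  pair : Fin (4 * genus) → Fin (4 * genus)
  pair_pair : ∀ s, pair (pair s) = s
  pair_ne : ∀ s, pair s ≠ s
  one_corner : ∀ c c' : Fin (4 * genus), Relation.EqvGen
    (fun c c' : Fin (4 * genus) => (c' : ℕ) = ((pair c : ℕ) + 1) % (4 * genus)) c c'
  holes : ℕ
  center : Fin holes → ℂ
  radius : Fin holes → ℝ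
  radius_pos : ∀ h, 0 < radius h
  hole_subset : ∀ h, Metric.closedBall (center h) (radius h) ⊆ openFace genus
  hole_disjoint : ∀ h h', h ≠ h' →
    Disjoint (Metric.closedBall (center h) (radius h)) (Metric.closedBall (center h') (radius h'))
  has_boundary : genus = 0 ∨ 0 < holes

namespace PuncturedPolygon

variable (D : PuncturedPolygon)

/-- The open fundamental domain: all points of the surface that are neither on its boundary
nor on a side of the polygon. -/
def openDomain : Set ℂ :=
  openFace D.genus \ ⋃ h, Metric.closedBall (D.center h) (D.radius h)

/-- The gluing of the sides. -/
def Glue (z w : ℂ) : Prop :=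
  ∃ s : Fin (4 * D.genus), ∃ a ∈ Icc (0 : ℝ) 1,
    z = sidePoint D.genus (s : ℕ) a ∧ w = sidePoint D.genus (D.pair s : ℕ) (1 - a)

/-- Points modulo the gluing; the points of the surface are the classes of the points in the
punctured polygon. -/
def Point : Type := Quot D.Glue

def proj (z : ℂ) : D.Point := Quot.mk _ z

/-- The boundary components: one for each hole and, in genus `0`, the unit circle (`none`). -/
def Component : Type := {o : Option (Fin D.holes) // o = none → D.genus = 0}

/-- The number `b` of boundary components. -/
def numComponents : ℕ := D.holes + if D.genus = 0 then 1 else 0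

variable {D}

def Component.center (c : D.Component) : ℂ := c.1.elim 0 D.center

def Component.radius (c : D.Component) : ℝ := c.1.elim 1 D.radius

/-- The boundary circle, a smooth closed curve. -/
def Component.circle (c : D.Component) : Set ℂ := Metric.sphere c.center c.radius

/-- `1` for the external circle and `-1` for a hole: the surface lies to the left of the circle
when the circle is traversed counterclockwise, respectively clockwise. -/
def Component.sign (c : D.Component) : ℝ := c.1.elim 1 (fun _ => -1)

/-- The vector `u` at the point `z` of the boundary circle `c` points strictly into the surface. -/
def Component.PointsInward (c : D.Component) (z u : ℂ) : Prop :=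
  c.sign * (conj (z - c.center) * u).re < 0

theorem Component.radius_pos (c : D.Component) : 0 < c.radius := by
  rcases c with ⟨_ | h, hc⟩
  · exact one_pos
  · exact D.radius_pos h

variable (D) in
def boundary : Set ℂ := ⋃ c : D.Component, c.circle

/-- The arc of the boundary circle `c` of angular length `ℓ` starting at angle `a`. For `σ = 1` the
surface lies to the left of the arc, for `σ = -1` to its right. -/
def circleArc (σ : ℤˣ) (c : D.Component) (a ℓ : ℝ) (hℓ : 0 < ℓ) : PlanarArc where
  toFun t := c.center + c.radius *
    Complex.exp (((a + ((σ : ℤ) : ℝ) * c.sign * ℓ * t : ℝ) : ℂ) * Complex.I)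
  smooth := by
    refine contDiff_const.add (contDiff_const.mul (ContDiff.cexp (ContDiff.mul ?_ contDiff_const)))
    exact Complex.ofRealCLM.contDiff.comp (contDiff_const.add (contDiff_const.mul contDiff_id))
  regular t _ := by
    have h1 : HasDerivAt (fun t : ℝ => a + ((σ : ℤ) : ℝ) * c.sign * ℓ * t)
        (((σ : ℤ) : ℝ) * c.sign * ℓ) t := by
      simpa using ((hasDerivAt_id t).const_mul (((σ : ℤ) : ℝ) * c.sign * ℓ)).const_add a
    have h2 := (((h1.ofReal_comp).mul_const Complex.I).cexp.const_mul
      (c.radius : ℂ)).const_add c.center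
    rw [h2.deriv]
    have hs : c.sign ≠ 0 := by
      rcases c with ⟨_ | h, hc⟩ <;> simp [Component.sign]
    have hσ : (((σ : ℤ) : ℝ)) ≠ 0 := by exact_mod_cast σ.ne_zero
    have hr := c.radius_pos.ne'
    refine mul_ne_zero (by exact_mod_cast hr) (mul_ne_zero (Complex.exp_ne_zero _)
      (mul_ne_zero ?_ Complex.I_ne_zero))
    exact_mod_cast mul_ne_zero (mul_ne_zero hσ hs) hℓ.ne'

theorem side_ne (g : ℕ) (hg : 0 < g) (k : ℤ) :
    polygonCorner g (k + 1) - polygonCorner g k ≠ 0 := by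
  intro h
  have h1 : polygonCorner g (k + 1) = polygonCorner g k := sub_eq_zero.mp h
  obtain ⟨n, hn⟩ := Complex.exp_eq_exp_iff_exists_int.mp h1
  have hg' : (g : ℂ) ≠ 0 := by exact_mod_cast hg.ne'
  have hp : (2 * Real.pi * Complex.I : ℂ) ≠ 0 := Complex.two_pi_I_ne_zero
  have h2 : (2 * Real.pi * Complex.I : ℂ) * 1 = (2 * Real.pi * Complex.I : ℂ) * (4 * g * n) := by
    push_cast at hn
    field_simp at hn
    linear_combination (2 * Real.pi * Complex.I : ℂ) * hn
  have h3 := mul_left_cancel₀ hp h2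
  have h4 : (1 : ℤ) = 4 * g * n := by exact_mod_cast h3
  have : (4 : ℤ) ∣ 1 := ⟨g * n, by rw [h4]; ring⟩
  norm_num at this

/-- The segment of side `k` of the `4g`-gon from parameter `a` to parameter `b`. -/
def sideArc (g : ℕ) (hg : 0 < g) (k : ℤ) (a b : ℝ) (hab : a ≠ b) : PlanarArc where
  toFun t := sidePoint g k (a + (b - a) * t)
  smooth := by
    refine contDiff_const.add (ContDiff.mul ?_ contDiff_const)
    exact Complex.ofRealCLM.contDiff.comp (contDiff_const.add (contDiff_const.mul contDiff_id))
  regular t _ := by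
    have h1 : HasDerivAt (fun t : ℝ => a + (b - a) * t) (b - a) t := by
      simpa using ((hasDerivAt_id t).const_mul (b - a)).const_add a
    have h2 := ((h1.ofReal_comp).mul_const
      (polygonCorner g (k + 1) - polygonCorner g k)).const_add (polygonCorner g k)
    have h3 : deriv (fun t : ℝ => sidePoint g k (a + (b - a) * t)) t = _ := h2.deriv
    rw [h3]
    refine mul_ne_zero ?_ (side_ne g hg k)
    exact_mod_cast sub_ne_zero.mpr hab.symm

/-! ### Curves on the surface -/

variable (D) in
/-- A crossing of a side of the polygon: leave through side `side` at parameter `param` and enter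
through the side glued to it. -/
structure Crossing where
  side : Fin (4 * D.genus)
  param : ℝ
  param_pos : 0 < param
  param_lt : param < 1

namespace Crossing

theorem genus_pos (x : D.Crossing) : 0 < D.genus := by
  have := x.side.2
  omega

/-- The same crossing in the opposite direction. -/
def reverse (x : D.Crossing) : D.Crossing where
  side := D.pair x.side
  param := 1 - x.param
  param_pos := by linarith [x.param_lt]
  param_lt := by linarith [x.param_pos]

def exitPoint (x : D.Crossing) : ℂ := sidePoint D.genus (x.side : ℕ) x.param

def entryPoint (x : D.Crossing) : ℂ := x.reverse.exitPoint

/-- Direction of the exit side, which has the polygon to its left. -/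
def sideDir (x : D.Crossing) : ℂ :=
  polygonCorner D.genus ((x.side : ℕ) + 1) - polygonCorner D.genus (x.side : ℕ)

/-- The number of corners passed when following the sides clockwise from exit to entry. -/
def steps (x : D.Crossing) : ℕ := (x.side + 4 * D.genus - D.pair x.side) % (4 * D.genus)

/-- The polygonal curve following the sides of the polygon clockwise from the exit point to the
entry point. -/
def detour (x : D.Crossing) : List PlanarArc :=
  sideArc D.genus x.genus_pos (x.side : ℕ) x.param 0 x.param_pos.ne' ::
    (List.range (x.steps - 1)).map (fun k =>
      sideArc D.genus x.genus_pos ((x.side : ℕ) - (k + 1 : ℕ)) 1 0 one_ne_zero) ++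
    [sideArc D.genus x.genus_pos (D.pair x.side : ℕ) 1 (1 - x.param)
      (by linarith [x.param_pos] : 1 - x.param < 1).ne']

end Crossing

variable (D) in
/-- A curve on the surface, seen in the plane: arcs in the punctured polygon, with a crossing of a
side between two consecutive arcs. -/
structure Curve where
  num : ℕ
  arc : Fin (num + 1) → PlanarArc
  cross : Fin num → D.Crossing

namespace Curve

def start (c : D.Curve) : ℂ := (c.arc 0).start

def finish (c : D.Curve) : ℂ := (c.arc (Fin.last _)).finish

def startDir (c : D.Curve) : ℂ := (c.arc 0).vel 0

def finishDir (c : D.Curve) : ℂ := (c.arc (Fin.last _)).vel 1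

def reverse (c : D.Curve) : D.Curve where
  num := c.num
  arc k := (c.arc k.rev).reverse
  cross k := (c.cross k.rev).reverse

/-- The curve in the plane that runs through the arcs and connects each exit point to the
next entry point clockwise along the sides of the polygon. -/
def drawn (c : D.Curve) : List PlanarArc :=
  c.arc 0 :: (List.finRange c.num).flatMap (fun k => (c.cross k).detour ++ [c.arc k.succ])

/-- The points of the surface on the curve. -/
def trace (c : D.Curve) : Set D.Point :=
  {x | ∃ k, ∃ t ∈ Icc (0 : ℝ) 1, x = D.proj ((c.arc k).toFun t)}

/-- `c` is a smooth simple curve (simple closed if its ends agree) whose points other than its ends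
are interior points of the surface, and which meets the sides of the polygon transversally
and not in the corners. (No relation is imposed between the lengths and angles of the velocity
on the two sides of a crossing: they depend on the choice of the gluing maps.) -/
structure IsEmbedded (c : D.Curve) : Prop where
  mem_domain : ∀ k, ∀ t ∈ Ioo (0 : ℝ) 1, (c.arc k).toFun t ∈ D.openDomain
  exit_eq : ∀ k, (c.arc k.castSucc).finish = (c.cross k).exitPoint
  entry_eq : ∀ k, (c.arc k.succ).start = (c.cross k).entryPoint
  exit_transversal : ∀ k, (conj (c.cross k).sideDir * (c.arc k.castSucc).vel 1).im < 0
  entry_transversal : ∀ k, 0 < (conj (c.cross k).reverse.sideDir * (c.arc k.succ).vel 0).im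
  simple : ∀ k k', ∀ t ∈ Ico (0 : ℝ) 1, ∀ t' ∈ Ico (0 : ℝ) 1,
    D.proj ((c.arc k).toFun t) = D.proj ((c.arc k').toFun t') → k = k' ∧ t = t'
  simple_finish : ∀ k, ∀ t ∈ Ico (0 : ℝ) 1,
    D.proj ((c.arc k).toFun t) = D.proj c.finish → k = 0 ∧ t = 0

end Curve

end PuncturedPolygon

/-! ### Directed networks on the surface -/

/-- A directed network with vertex set `V` and edge set `E` embedded on the surface `D`. -/
structure Network (D : PuncturedPolygon) (V E : Type*) where
  src : E → V
  tgt : E → V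
  pos : V → ℂ
  pos_injective : Function.Injective pos
  pos_mem : ∀ v, pos v ∈ D.openDomain ∨ pos v ∈ D.boundary
  curve : E → D.Curve
  curve_embedded : ∀ e, (curve e).IsEmbedded
  start_eq : ∀ e, (curve e).start = pos (src e)
  finish_eq : ∀ e, (curve e).finish = pos (tgt e)
  vertex_on_edge : ∀ v e, D.proj (pos v) ∈ (curve e).trace → v = src e ∨ v = tgt e
  edges_disjoint : ∀ e f, e ≠ f → ∀ x ∈ (curve e).trace, x ∈ (curve f).trace →
    ∃ v, x = D.proj (pos v)
  -- edges are not tangent to the boundary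
  start_inward : ∀ e (c : D.Component), pos (src e) ∈ c.circle →
    c.PointsInward (pos (src e)) (curve e).startDir
  finish_outward : ∀ e (c : D.Component), pos (tgt e) ∈ c.circle →
    c.PointsInward (pos (tgt e)) (-(curve e).finishDir)
  -- paths have corners but no cusps at the vertices, so that they can be smoothed
  no_cusp : ∀ e f, tgt e = src f →
    ¬ ∃ r : ℝ, r < 0 ∧ (curve f).startDir = r * (curve e).finishDir

namespace Network

variable {D : PuncturedPolygon} {V E : Type*} (N : Network D V E)

/-- The set `K` of boundary vertices. -/
def K : Set V := {v | N.pos v ∈ D.boundary}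

/-- The set `I` of boundary vertices that are sources. -/
def I : Set V := {v | v ∈ N.K ∧ ∀ e, N.tgt e ≠ v}

def inDegree (v : V) : ℕ := {e | N.tgt e = v}.ncard

def outDegree (v : V) : ℕ := {e | N.src e = v}.ncard

/-- Boundary vertices are univalent (hence a source or a sink); interior vertices are trivalent and
neither a source nor a sink. -/
def PerfectlyOriented : Prop :=
  (∀ v ∈ N.K, N.inDegree v + N.outDegree v = 1) ∧
  (∀ v ∉ N.K, N.inDegree v + N.outDegree v = 3 ∧ N.inDegree v ≠ 0 ∧ N.outDegree v ≠ 0)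

/-- The list of edges is a path from `i` to `j`. -/
def IsPath : V → List E → V → Prop
  | i, [], j => i = j
  | i, e :: P, j => N.src e = i ∧ IsPath (N.tgt e) P j

/-- The paths from `i` to `j`. -/
def Path (i j : V) : Type _ := {P : List E // N.IsPath i P j}

variable {N} in
/-- The weight of a path, for edge weights `y`. -/
def Path.wt {i j : V} (P : N.Path i j) (y : E → MvPowerSeries E ℝ) : MvPowerSeries E ℝ :=
  (P.1.map y).prod

/-- The weighted path matrix `M(N, y)`. The sum over all paths is taken in the ring of formal power
series with the topology of coefficientwise convergence. -/
def M (y : E → MvPowerSeries E ℝ) : Matrix V V (MvPowerSeries E ℝ) :=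
  Matrix.of fun i j => ∑' P : N.Path i j, P.wt y

/-- The restriction `A(N, y)` of the weighted path matrix to the rows `I` and columns `K`. -/
def A (y : E → MvPowerSeries E ℝ) : Matrix N.I N.K (MvPowerSeries E ℝ) :=
  (N.M y).submatrix Subtype.val Subtype.val

end Network

/-! ### Cuts and the boundary of the cut surface -/

/-- A piece of the boundary of the cut surface: an arc of a boundary circle of the original
surface, or one of the two sides of a cut (`rev` says in which direction the cut is followed). -/
inductive BoundaryPiece (D : PuncturedPolygon)
  | arc (c : D.Component) (a ℓ : ℝ) (hℓ : 0 < ℓ) : BoundaryPiece D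
  | cut (k : Fin (D.numComponents - 1)) (rev : Bool) : BoundaryPiece D

namespace BoundaryPiece

variable {D : PuncturedPolygon}

def IsCut : BoundaryPiece D → Prop
  | arc _ _ _ _ => False
  | cut _ _ => True

/-- The cut `k`, followed in the given direction. -/
def cutCurve (cuts : Fin (D.numComponents - 1) → D.Curve) (k : Fin (D.numComponents - 1))
    (rev : Bool) : D.Curve :=
  if rev then (cuts k).reverse else cuts k

/-- The piece as a curve in the plane. -/
def drawn (cuts : Fin (D.numComponents - 1) → D.Curve) (σ : ℤˣ) :
    BoundaryPiece D → List PlanarArc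
  | arc c a ℓ hℓ => [PuncturedPolygon.circleArc σ c a ℓ hℓ]
  | cut k rev => (cutCurve cuts k rev).drawn

def start (cuts : Fin (D.numComponents - 1) → D.Curve) (σ : ℤˣ) : BoundaryPiece D → ℂ
  | arc c a ℓ hℓ => (PuncturedPolygon.circleArc σ c a ℓ hℓ).start
  | cut k rev => (cutCurve cuts k rev).start

def finish (cuts : Fin (D.numComponents - 1) → D.Curve) (σ : ℤˣ) : BoundaryPiece D → ℂ
  | arc c a ℓ hℓ => (PuncturedPolygon.circleArc σ c a ℓ hℓ).finish
  | cut k rev => (cutCurve cuts k rev).finish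

end BoundaryPiece

/-- A choice of `b - 1` cuts between pairs of boundary components, such that the cut surface `T` has
a single boundary component, and a piecewise smooth parameterization of `∂T`.

The parameterization is given by its sequence of pieces `piece 0, …, piece (len - 1)`, followed
cyclically: it passes once along each side of each cut and once along each boundary circle, always
with the surface on the same side (to the left if `orient = 1`, to the right if `orient = -1`), and
it turns at every end of a cut from the cut into the boundary circle and from the boundary
circle into the cut. Arcs of boundary circles may be subdivided, and they are subdivided at least at
the boundary vertices of the network: `place v` is the number of the piece that starts at `v`. -/
structure CutSurface {D : PuncturedPolygon} {V E : Type*} (N : Network D V E) where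
  cuts : Fin (D.numComponents - 1) → D.Curve
  cuts_embedded : ∀ k, (cuts k).IsEmbedded
  cuts_ends : ∀ k, ∃ c c' : D.Component, c ≠ c' ∧
    (cuts k).start ∈ c.circle ∧ (cuts k).finish ∈ c'.circle ∧
    c.PointsInward (cuts k).start (cuts k).startDir ∧
    c'.PointsInward (cuts k).finish (-(cuts k).finishDir)
  cuts_disjoint : ∀ k k', k ≠ k' → Disjoint (cuts k).trace (cuts k').trace
  cuts_vertices : ∀ k v, D.proj (N.pos v) ∉ (cuts k).trace
  cuts_transversal : ∀ k e m n, ∀ t ∈ Icc (0 : ℝ) 1, ∀ u ∈ Icc (0 : ℝ) 1,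
    ((cuts k).arc m).toFun t = ((N.curve e).arc n).toFun u →
      (conj (((cuts k).arc m).vel t) * ((N.curve e).arc n).vel u).im ≠ 0
  orient : ℤˣ
  len : ℕ
  len_pos : 0 < len
  piece : Fin len → BoundaryPiece D
  piece_joins : ∀ m m' : Fin len, (m' : ℕ) = (m + 1) % len →
    (piece m).finish cuts orient = (piece m').start cuts orient
  piece_alternates : ∀ m m' : Fin len, (m' : ℕ) = (m + 1) % len →
    ¬ ((piece m).IsCut ∧ (piece m').IsCut)
  cut_once : ∀ k rev, ∃! m, piece m = BoundaryPiece.cut k rev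
  circle_once : ∀ (c : D.Component), ∀ z ∈ c.circle, ∃! p : Fin len × ℝ,
    p.2 ∈ Ico (0 : ℝ) 1 ∧ ∃ a ℓ hℓ, piece p.1 = BoundaryPiece.arc c a ℓ hℓ ∧
      (PuncturedPolygon.circleArc orient c a ℓ hℓ).toFun p.2 = z
  place : N.K → Fin len
  place_arc : ∀ v, ¬ (piece (place v)).IsCut
  place_start : ∀ v, (piece (place v)).start cuts orient = N.pos v

namespace CutSurface

variable {D : PuncturedPolygon} {V E : Type*} {N : Network D V E} (T : CutSurface N)

/-- The part of `∂T` followed, in the chosen direction, from the boundary vertex `j` to the boundary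
vertex `i`; once around if `i = j`. -/
def boundaryFromTo (j i : N.K) : List PlanarArc :=
  let d := ((T.place i : ℕ) + T.len - T.place j) % T.len
  (List.range (if d = 0 then T.len else d)).flatMap fun m =>
    (T.piece ⟨(T.place j + m) % T.len, Nat.mod_lt _ T.len_pos⟩).drawn T.cuts T.orient

/-- The closed curve `C(P)` in the plane: the path `P` from `i` to `j`, then `∂T` from `j` to `i`. -/
def closedCurve (i j : N.K) (P : N.Path i j) : List PlanarArc :=
  P.1.flatMap (fun e => (N.curve e).drawn) ++ T.boundaryFromTo j i

/-- The number `s_{ij}` of boundary sources strictly between `i` and `j`, in the linear order of the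
boundary vertices along the parameterization of `∂T`. -/
def between (i j : N.K) : ℕ :=
  {k : N.K | k.1 ∈ N.I ∧ ((T.place i < T.place k ∧ T.place k < T.place j) ∨
    (T.place j < T.place k ∧ T.place k < T.place i))}.ncard

/-- The boundary measurement matrix `B(N, y)`. -/
def B (y : E → MvPowerSeries E ℝ) : Matrix N.I N.K (MvPowerSeries E ℝ) :=
  Matrix.of fun i j => ∑' P : N.Path i j,
    ((-1 : ℝ) ^ ((T.between ⟨i, i.2.1⟩ j : ℤ) +
      PlanarArc.rotationNumber (T.closedCurve ⟨i, i.2.1⟩ j P) + 1)) • P.wt y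

end CutSurface

/-- The series defining `M`, `A` and `B` converge for all edge weights `a_e x_e`. -/
theorem Network.summable_wt {D : PuncturedPolygon} {V E : Type*} [Finite E] (N : Network D V E)
    (i j : V) (a : E → ℝ) (c : N.Path i j → ℝ) :
    Summable fun P : N.Path i j =>
      c P • P.wt (fun e => MvPowerSeries.C (a e) * MvPowerSeries.X e) := by
  classical
  have hwt : ∀ l : List E,
      (l.map fun e => (MvPowerSeries.C (a e) * MvPowerSeries.X e : MvPowerSeries E ℝ)).prod =
        MvPowerSeries.monomial (l.map fun e => Finsupp.single e 1).sum (l.map a).prod := by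
    intro l
    induction l with
    | nil => simp
    | cons e l ih =>
      simp only [List.map_cons, List.prod_cons, List.sum_cons, ih]
      rw [MvPowerSeries.X, ← MvPowerSeries.monomial_zero_eq_C_apply,
        MvPowerSeries.monomial_mul_monomial, MvPowerSeries.monomial_mul_monomial]
      simp
  rw [MvPowerSeries.WithPiTopology.summable_iff_summable_coeff]
  intro d
  apply summable_of_hasFiniteSupport
  have hlen : ∀ l : List E,
      ((l.map fun e => (Finsupp.single e 1 : E →₀ ℕ)).sum).degree = l.length := by
    intro l
    induction l with
    | nil => simp
    | cons e l ih => simp [ih, add_comm]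
  refine Set.Finite.subset (((List.finite_length_eq E d.degree).preimage
    Subtype.val_injective.injOn : Set.Finite {P : N.Path i j | P.1.length = d.degree})) ?_
  intro P hP
  by_contra hne
  apply hP
  have : (P.1.map fun e => (Finsupp.single e 1 : E →₀ ℕ)).sum ≠ d := by
    rintro rfl
    exact hne (hlen P.1).symm
  simp only [Network.Path.wt, hwt, map_smul, MvPowerSeries.coeff_monomial, smul_eq_mul]
  rw [if_neg (Ne.symm this), mul_zero]

end

/-!
Following the unit tangent once around the boundary of the cut surface gives an odd rotation number,
since every boundary circle contributes `±1` and the two sides of a cut, traversed in opposite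
directions, together contribute an odd number. Fix a lift of the tangent angle along this boundary.
At a vertex with at most one incoming or at most one outgoing edge, the angles of all the edges can
be lifted to real numbers whose differences are the exterior angles of the paths through the vertex;
at a boundary vertex they can be lifted compatibly with the boundary. The turning of the tangent
along a closed curve `C(P)` then telescopes: every edge contributes an integer which does not depend
on `P`, and the boundary contributes its rotation number exactly if `j` does not come before `i`.
The parity of `s_ij` is the difference of the parities of the numbers of sources before `i` and
before `j`, up to the same correction. Hence the sign of `P` is a product over its edges of signs
that depend only on the edge.
-/

theorem coe_arg_ofReal_mul_exp {r : ℝ} (hr : 0 < r) (θ : ℝ) :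
    ((r * Complex.exp (θ * Complex.I) : ℂ).arg : Real.Angle) = θ := by
  rw [Complex.arg_real_mul _ hr, Complex.arg_exp_mul_I, Real.Angle.coe_toIocMod]

namespace PlanarArc

/-! ### Turning of chains of arcs -/

section Turning

variable (γ : PlanarArc)

theorem vel_ne_zero {t : ℝ} (ht : t ∈ Icc (0 : ℝ) 1) : γ.vel t ≠ 0 := γ.regular t ht

theorem exists_continuousOn_coe_eq_arg_vel : ∃ θ : ℝ → ℝ, ContinuousOn θ (Icc 0 1) ∧
    (∀ t ∈ Icc (0 : ℝ) 1, ((γ.vel t).arg : Real.Angle) = θ t) ∧ γ.turning = θ 1 - θ 0 := by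
  obtain ⟨hθ, hvel⟩ := γ.exists_angle.choose_spec
  refine ⟨_, hθ, fun t ht => ?_, rfl⟩
  rw [hvel t ht, coe_arg_ofReal_mul_exp (norm_pos_iff.mpr (γ.vel_ne_zero ht))]

/-- Two continuous angles of the tangent vector differ by a constant, as `ℝ` covers the circle. -/
theorem turning_eq {θ : ℝ → ℝ} (hθ : ContinuousOn θ (Icc 0 1)) (c : Real.Angle)
    (h : ∀ t ∈ Icc (0 : ℝ) 1, ((γ.vel t).arg : Real.Angle) = θ t + c) :
    γ.turning = θ 1 - θ 0 := by
  obtain ⟨φ, hφ, hvel, hturn⟩ := γ.exists_continuousOn_coe_eq_arg_vel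
  have hcover : IsCoveringMap ((↑) : ℝ → Real.Angle) := AddCircle.isCoveringMap_coe _
  have hlift : EqOn φ (fun t => θ t + (φ 0 - θ 0)) (Icc 0 1) := by
    refine hcover.eqOn_of_comp_eqOn isPreconnected_Icc hφ (hθ.add continuousOn_const)
      (fun t ht => ?_) (left_mem_Icc.mpr zero_le_one) (by ring)
    have h0 : (0 : ℝ) ∈ Icc (0 : ℝ) 1 := left_mem_Icc.mpr zero_le_one
    simp only [Function.comp_apply, Real.Angle.coe_add, Real.Angle.coe_sub, ← hvel t ht,
      ← hvel 0 h0, h t ht, h 0 h0]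
    abel
  rw [hturn, hlift (right_mem_Icc.mpr zero_le_one)]
  ring

theorem coe_turning : (γ.turning : Real.Angle) = (γ.vel 1).arg - (γ.vel 0).arg := by
  obtain ⟨θ, -, hvel, hturn⟩ := γ.exists_continuousOn_coe_eq_arg_vel
  rw [hturn, Real.Angle.coe_sub, hvel 1 (by simp), hvel 0 (by simp)]

theorem reverse_vel (t : ℝ) : γ.reverse.vel t = -γ.vel (1 - t) := by
  simp only [vel, reverse, deriv_comp_const_sub]

theorem reverse_turning : γ.reverse.turning = -γ.turning := by
  obtain ⟨θ, hθ, hvel, hturn⟩ := γ.exists_continuousOn_coe_eq_arg_vel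
  have hmaps : MapsTo (fun t : ℝ => 1 - t) (Icc 0 1) (Icc 0 1) := fun t ht =>
    ⟨by linarith [ht.2], by linarith [ht.1]⟩
  rw [turning_eq γ.reverse (hθ.comp (by fun_prop) hmaps) Real.pi fun t ht => ?_, hturn]
  · simp
  · rw [reverse_vel, Complex.arg_neg_coe_angle (γ.vel_ne_zero (hmaps ht)), hvel _ (hmaps ht)]
    rfl

theorem reverse_start : γ.reverse.start = γ.finish := by simp [start, finish, reverse]

theorem reverse_finish : γ.reverse.finish = γ.start := by simp [start, finish, reverse]

end Turning

section Chains

/-- The initial velocity of a chain of arcs (`1` for the empty chain). -/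
noncomputable def headVel : List PlanarArc → ℂ
  | [] => 1
  | γ :: _ => γ.vel 0

/-- The final velocity of a chain of arcs (`1` for the empty chain). -/
noncomputable def lastVel : List PlanarArc → ℂ
  | [] => 1
  | [γ] => γ.vel 1
  | _ :: δ :: l => lastVel (δ :: l)

/-- The exterior angle at the corner where a chain of arcs is followed by another one. -/
noncomputable def cornerAngle (l m : List PlanarArc) : ℝ := (headVel m / lastVel l).arg

/-- The turning of the tangent vector along a chain of arcs that need not be closed: the corner
between the last arc and the first one is left out. -/
noncomputable def pathTurning : List PlanarArc → ℝ
  | [] => 0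
  | [γ] => γ.turning
  | γ :: δ :: l => γ.turning + extAngle γ δ + pathTurning (δ :: l)

variable {l m : List PlanarArc}

theorem headVel_ne_zero : ∀ l, headVel l ≠ 0
  | [] => one_ne_zero
  | γ :: _ => γ.vel_ne_zero (by simp)

theorem lastVel_ne_zero : ∀ l, lastVel l ≠ 0
  | [] => one_ne_zero
  | [γ] => γ.vel_ne_zero (by simp)
  | _ :: δ :: l => lastVel_ne_zero (δ :: l)

theorem headVel_append (hl : l ≠ []) (m : List PlanarArc) : headVel (l ++ m) = headVel l := by
  cases l with
  | nil => exact absurd rfl hl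
  | cons γ l => rfl

theorem lastVel_append (l : List PlanarArc) (hm : m ≠ []) : lastVel (l ++ m) = lastVel m := by
  obtain ⟨δ, m, rfl⟩ := List.exists_cons_of_ne_nil hm
  induction l using lastVel.induct with
  | case1 | case2 => rfl
  | case3 _ _ _ ih => exact ih

theorem pathTurning_append (hl : l ≠ []) (hm : m ≠ []) :
    pathTurning (l ++ m) = pathTurning l + cornerAngle l m + pathTurning m := by
  obtain ⟨δ, m, rfl⟩ := List.exists_cons_of_ne_nil hm
  induction l using pathTurning.induct with
  | case1 => exact absurd rfl hl
  | case2 γ => rfl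
  | case3 γ γ' l ih =>
    simp only [List.cons_append, pathTurning, cornerAngle, lastVel] at ih ⊢
    rw [ih (by simp)]
    ring

theorem coe_cornerAngle (l m : List PlanarArc) :
    (cornerAngle l m : Real.Angle) = (headVel m).arg - (lastVel l).arg :=
  Complex.arg_div_coe_angle (headVel_ne_zero m) (lastVel_ne_zero l)

theorem coe_pathTurning :
    ∀ l, (pathTurning l : Real.Angle) = (lastVel l).arg - (headVel l).arg
  | [] => by simp [pathTurning, lastVel, headVel]
  | [γ] => γ.coe_turning
  | γ :: δ :: l => by
    have hcorner : (extAngle γ δ : Real.Angle) = (δ.vel 0).arg - (γ.vel 1).arg :=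
      coe_cornerAngle [γ] [δ]
    rw [pathTurning, Real.Angle.coe_add, Real.Angle.coe_add, γ.coe_turning, hcorner,
      coe_pathTurning (δ :: l), lastVel, headVel, headVel]
    abel

theorem sum_turning_add_sum_extAngle (γ : PlanarArc) (l : List PlanarArc) (δ : PlanarArc) :
    ((γ :: l).map turning).sum + (List.zipWith extAngle (γ :: l) (l ++ [δ])).sum =
      pathTurning (γ :: l) + cornerAngle (γ :: l) [δ] := by
  induction l generalizing γ with
  | nil => simp [pathTurning, lastVel, extAngle, cornerAngle, headVel]
  | cons γ' l ih =>
    have := ih γ'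
    simp only [List.map_cons, List.sum_cons, List.cons_append, List.zipWith_cons_cons,
      pathTurning, lastVel, cornerAngle] at this ⊢
    linarith

theorem two_pi_mul_rotationNumber (hl : l ≠ []) :
    2 * Real.pi * rotationNumber l = pathTurning l + cornerAngle l l := by
  obtain ⟨γ, l, rfl⟩ := List.exists_cons_of_ne_nil hl
  rw [rotationNumber, ← (exists_rotationNumber _).choose_spec, totalTurning,
    List.rotate_cons_succ, List.rotate_zero]
  exact sum_turning_add_sum_extAngle γ l γ

end Chains

section Concatenation

variable {ι : Type*} {f : ι → List PlanarArc}

theorem flatMap_ne_nil (hf : ∀ a, f a ≠ []) {l : List ι} (hl : l ≠ []) : l.flatMap f ≠ [] := by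
  obtain ⟨a, l, rfl⟩ := List.exists_cons_of_ne_nil hl
  simp [hf a]

theorem headVel_flatMap (hf : ∀ a, f a ≠ []) {l : List ι} (hl : l ≠ []) :
    headVel (l.flatMap f) = headVel (f (l.head hl)) := by
  obtain ⟨a, l, rfl⟩ := List.exists_cons_of_ne_nil hl
  rw [List.flatMap_cons, headVel_append (hf a), List.head_cons]

theorem lastVel_flatMap (hf : ∀ a, f a ≠ []) {l : List ι} (hl : l ≠ []) :
    lastVel (l.flatMap f) = lastVel (f (l.getLast hl)) := by
  obtain ⟨l, a, rfl⟩ := (List.eq_nil_or_concat' l).resolve_left hl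
  rw [List.flatMap_append, List.flatMap_singleton, lastVel_append _ (hf a),
    List.getLast_append_singleton]

/-- If the corners telescope along a concatenation of chains, so does the turning. -/
theorem pathTurning_flatMap (hf : ∀ a, f a ≠ []) {s t n : ι → ℝ}
    (hturn : ∀ a, pathTurning (f a) = t a - s a + n a) :
    ∀ {l : List ι} (hl : l ≠ []), l.IsChain (fun a b => cornerAngle (f a) (f b) = s b - t a) →
      pathTurning (l.flatMap f) = t (l.getLast hl) - s (l.head hl) + (l.map n).sum
  | [a], _, _ => by simp [hturn]
  | a :: b :: l, _, hcorner => by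
    have hne : (b :: l).flatMap f ≠ [] := flatMap_ne_nil hf (List.cons_ne_nil b l)
    have hjoin : cornerAngle (f a) ((b :: l).flatMap f) = s b - t a := by
      rw [cornerAngle, headVel_flatMap hf (List.cons_ne_nil b l)]
      exact hcorner.rel
    rw [List.flatMap_cons, pathTurning_append (hf a) hne, hjoin, hturn,
      pathTurning_flatMap hf hturn (List.cons_ne_nil b l) hcorner.tail]
    simp only [List.head_cons, List.getLast_cons_cons, List.map_cons, List.sum_cons]
    ring

end Concatenation

section Sequences

variable {f : ℕ → List PlanarArc}

/-- The angle of the tangent vector at the start of the chain `f n`, followed continuously along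
the chains `f 0, …, f (n - 1)`, with corners turning by their exterior angles. -/
noncomputable def startAngle (f : ℕ → List PlanarArc) : ℕ → ℝ
  | 0 => (headVel (f 0)).arg
  | n + 1 => startAngle f n + pathTurning (f n) + cornerAngle (f n) (f (n + 1))

theorem startAngle_succ (f : ℕ → List PlanarArc) (n : ℕ) :
    startAngle f (n + 1) = startAngle f n + pathTurning (f n) + cornerAngle (f n) (f (n + 1)) :=
  rfl

theorem coe_startAngle (f : ℕ → List PlanarArc) (n : ℕ) :
    (startAngle f n : Real.Angle) = (headVel (f n)).arg := by
  induction n with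
  | zero => rfl
  | succ n ih =>
    rw [startAngle_succ, Real.Angle.coe_add, Real.Angle.coe_add, ih, coe_pathTurning,
      coe_cornerAngle]
    abel

theorem startAngle_sub_startAngle_zero (f : ℕ → List PlanarArc) (n : ℕ) :
    startAngle f n - startAngle f 0 =
      ∑ m ∈ Finset.range n, (pathTurning (f m) + cornerAngle (f m) (f (m + 1))) := by
  rw [← Finset.sum_range_sub]
  exact Finset.sum_congr rfl fun m _ => by rw [startAngle_succ]; ring

theorem startAngle_add_period {b : ℕ} (hf : Function.Periodic f b) (n : ℕ) :
    startAngle f (n + b) = startAngle f n + (startAngle f b - startAngle f 0) := by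
  induction n with
  | zero => simp
  | succ n ih =>
    rw [add_right_comm, startAngle_succ, startAngle_succ, ih, hf n, add_right_comm n, hf]
    ring

theorem pathTurning_flatMap_range (hf : ∀ n, f n ≠ []) (p n : ℕ) :
    pathTurning ((List.range (n + 1)).flatMap fun m => f (p + m)) =
      startAngle f (p + n + 1) - cornerAngle (f (p + n)) (f (p + n + 1)) - startAngle f p := by
  rw [pathTurning_flatMap (fun m => hf (p + m)) (s := fun m => startAngle f (p + m))
    (t := fun m => startAngle f (p + m) + pathTurning (f (p + m))) (n := fun _ => 0)
    (fun m => by simp) (by simp)]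
  · simp [startAngle_succ]
  · exact (List.isChain_range_succ _ _).mpr fun m _ => by simp [startAngle_succ, ← add_assoc]

end Sequences

section Joined

/-- The arcs of a sequence, joined by chains of arcs between consecutive ones. -/
def joined {n : ℕ} (arc : Fin (n + 1) → PlanarArc) (join : Fin n → List PlanarArc) :
    List PlanarArc :=
  arc 0 :: (List.finRange n).flatMap fun k => join k ++ [arc k.succ]

theorem joined_succ {n : ℕ} (arc : Fin (n + 2) → PlanarArc)
    (join : Fin (n + 1) → List PlanarArc) :
    joined arc join = joined (fun k => arc k.castSucc) (fun k => join k.castSucc) ++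
      (join (Fin.last n) ++ [arc (Fin.last (n + 1))]) := by
  rw [joined, List.finRange_succ_last]
  simp [joined, List.flatMap_append, List.flatMap_map]

theorem lastVel_joined {n : ℕ} (arc : Fin (n + 1) → PlanarArc)
    (join : Fin n → List PlanarArc) : lastVel (joined arc join) = (arc (Fin.last n)).vel 1 := by
  cases n with
  | zero => simp [joined, lastVel]
  | succ n => rw [joined_succ, lastVel_append _ (by simp), lastVel_append _ (by simp), lastVel]

theorem pathTurning_joined {n : ℕ} (arc : Fin (n + 1) → PlanarArc)
    {join : Fin n → List PlanarArc} (hjoin : ∀ k, join k ≠ []) :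
    pathTurning (joined arc join) = ∑ k, (arc k).turning +
      ∑ k, (cornerAngle [arc k.castSucc] (join k) + pathTurning (join k) +
        cornerAngle (join k) [arc k.succ]) := by
  induction n with
  | zero => simp [joined, pathTurning]
  | succ n ih =>
    have hcorner : cornerAngle (joined (fun k => arc k.castSucc) fun k => join k.castSucc)
        (join (Fin.last n) ++ [arc (Fin.last (n + 1))]) =
          cornerAngle [arc (Fin.last n).castSucc] (join (Fin.last n)) := by
      rw [cornerAngle, lastVel_joined, headVel_append (hjoin _), cornerAngle, lastVel]
    rw [joined_succ, pathTurning_append (by simp [joined]) (by simp), ih _ fun k => hjoin _,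
      hcorner, pathTurning_append (hjoin _) (by simp), pathTurning,
      Fin.sum_univ_castSucc fun k => (arc k).turning,
      Fin.sum_univ_castSucc fun k => _ + _ + cornerAngle (join k) [arc k.succ]]
    simp only [Fin.castSucc_succ, Fin.succ_last]
    ring

end Joined

end PlanarArc

/-! ### Exterior angles -/

theorem arg_ofReal_mul_div_ofReal_mul {r s : ℝ} (hr : 0 < r) (hs : 0 < s) (z w : ℂ) :
    (r * z / (s * w)).arg = (z / w).arg := by
  rw [mul_div_mul_comm, ← Complex.ofReal_div, Complex.arg_real_mul _ (div_pos hr hs)]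

theorem arg_add_arg_neg_inv_of_im_pos {z : ℂ} (hz : 0 < z.im) :
    z.arg + (-z⁻¹).arg = Real.pi := by
  have hinv : z⁻¹.im < 0 := by
    rw [Complex.inv_im]
    exact div_neg_of_neg_of_pos (neg_lt_zero.mpr hz)
      (Complex.normSq_pos.mpr fun h => hz.ne' (h ▸ Complex.zero_im))
  have hpi : z.arg ≠ Real.pi := fun h => hz.ne' (Complex.arg_eq_pi_iff.mp h).2
  rw [Complex.arg_neg_eq_arg_add_pi_of_im_neg hinv, Complex.arg_inv, if_neg hpi]
  ring

theorem arg_add_arg_neg_inv_of_im_neg {z : ℂ} (hz : z.im < 0) :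
    z.arg + (-z⁻¹).arg = -Real.pi := by
  have hinv : 0 < z⁻¹.im := by
    rw [Complex.inv_im]
    exact div_pos (neg_pos.mpr hz) (Complex.normSq_pos.mpr fun h => hz.ne (h ▸ Complex.zero_im))
  have hpi : z.arg ≠ Real.pi := fun h => hz.ne (Complex.arg_eq_pi_iff.mp h).2
  rw [Complex.arg_neg_eq_arg_sub_pi_of_im_pos hinv, Complex.arg_inv, if_neg hpi]
  ring

/-- A line in direction `u` is left along `t` and later entered in the opposite direction: the
exterior angles of the two corners add up to a half turn. -/
theorem arg_div_add_arg_div_neg {u t : ℂ} {s : ℤˣ}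
    (h : 0 < ((s : ℤ) : ℝ) * (conj t * u).im) :
    (u / t).arg + (t / -u).arg = (s : ℤ) * Real.pi := by
  have ht : t ≠ 0 := by rintro rfl; simp at h
  have him : (u / t).im = (conj t * u).im / Complex.normSq t := by
    simp [Complex.div_im]
    ring
  have hinv : t / -u = -(u / t)⁻¹ := by rw [inv_div, div_neg]
  have hdiv : 0 < ((s : ℤ) : ℝ) * (u / t).im := by
    rw [him, mul_div_assoc']
    exact div_pos h (Complex.normSq_pos.mpr ht)
  rw [hinv]
  obtain rfl | rfl := Int.units_eq_one_or s
  · rw [arg_add_arg_neg_inv_of_im_pos (by simpa using hdiv)]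
    simp
  · rw [arg_add_arg_neg_inv_of_im_neg (by simpa using hdiv)]
    simp

/-! ### Sides of the polygon -/

theorem polygonCorner_sub_one {g : ℕ} (hg : 0 < g) (k : ℤ) :
    polygonCorner g (k - 1) =
      Complex.exp ((-(2 * Real.pi / (4 * g)) : ℝ) * Complex.I) * polygonCorner g k := by
  have hg' : (g : ℂ) ≠ 0 := by exact_mod_cast hg.ne'
  rw [polygonCorner, polygonCorner, ← Complex.exp_add]
  congr 1
  push_cast
  field_simp
  ring

theorem polygonCorner_add_period {g : ℕ} (hg : 0 < g) (k n : ℤ) :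
    polygonCorner g (k + 4 * g * n) = polygonCorner g k := by
  have hg' : (g : ℂ) ≠ 0 := by exact_mod_cast hg.ne'
  rw [polygonCorner, polygonCorner, Complex.exp_eq_exp_iff_exists_int]
  refine ⟨n, ?_⟩
  push_cast
  field_simp

/-- The direction of the side from corner `k` to corner `k + 1`. -/
noncomputable def sideVec (g : ℕ) (k : ℤ) : ℂ := polygonCorner g (k + 1) - polygonCorner g k

theorem sideVec_sub_one {g : ℕ} (hg : 0 < g) (k : ℤ) :
    sideVec g (k - 1) =
      Complex.exp ((-(2 * Real.pi / (4 * g)) : ℝ) * Complex.I) * sideVec g k := by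
  rw [sideVec, sideVec, mul_sub, ← polygonCorner_sub_one hg, ← polygonCorner_sub_one hg,
    sub_add_cancel, add_sub_cancel_right]

theorem sideVec_eq_of_modEq {g : ℕ} (hg : 0 < g) {k l : ℤ} (h : k ≡ l [ZMOD (4 * g : ℕ)]) :
    sideVec g k = sideVec g l := by
  obtain ⟨n, hn⟩ := h.dvd
  obtain rfl : l = k + 4 * g * n := by push_cast at hn; linarith
  rw [sideVec, sideVec, polygonCorner_add_period hg, add_right_comm, polygonCorner_add_period hg]

theorem arg_sideVec_sub_one_div {g : ℕ} (hg : 0 < g) (k : ℤ) :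
    (sideVec g (k - 1) / sideVec g k).arg = -(2 * Real.pi / (4 * g)) := by
  have hone : (1 : ℝ) ≤ g := by exact_mod_cast hg
  have hlt : 2 * Real.pi / (4 * g) < Real.pi := by
    rw [div_lt_iff₀ (by positivity)]
    nlinarith [Real.pi_pos]
  have hpos : 0 < 2 * Real.pi / (4 * g) := by positivity
  have hne : sideVec g k ≠ 0 := PuncturedPolygon.side_ne g hg k
  rw [sideVec_sub_one hg, mul_div_cancel_right₀ _ hne, Complex.arg_exp_mul_I,
    toIocMod_eq_self]
  constructor <;> linarith

theorem PlanarArc.pathTurning_of_isChain_extAngle {α : ℝ} :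
    ∀ {l : List PlanarArc}, l ≠ [] → (∀ γ ∈ l, γ.turning = 0) →
      l.IsChain (fun γ δ => extAngle γ δ = α) → pathTurning l = (l.length - 1) * α
  | [γ], _, hturn, _ => by simp [pathTurning, hturn]
  | γ :: δ :: l, _, hturn, hcorner => by
    rw [pathTurning, hturn γ (by simp), hcorner.rel,
      pathTurning_of_isChain_extAngle (List.cons_ne_nil δ l)
        (fun ε hε => hturn ε (List.mem_cons_of_mem γ hε)) hcorner.tail]
    simp only [List.length_cons, Nat.cast_add, Nat.cast_one]
    ring

namespace PuncturedPolygon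

open PlanarArc

variable {D : PuncturedPolygon}

section Sides

variable {g : ℕ} (hg : 0 < g) (k : ℤ) {a b : ℝ}

theorem sideArc_vel (hab : a ≠ b) (t : ℝ) :
    (sideArc g hg k a b hab).vel t = (b - a : ℝ) * sideVec g k := by
  have hparam : HasDerivAt (fun t : ℝ => a + (b - a) * t) (b - a) t := by
    simpa using ((hasDerivAt_id t).const_mul (b - a)).const_add a
  exact ((hparam.ofReal_comp.mul_const _).const_add (polygonCorner g k)).deriv

theorem sideArc_turning (hab : a ≠ b) : (sideArc g hg k a b hab).turning = 0 := by
  rw [turning_eq _ (θ := fun _ => 0) continuousOn_const ((b - a : ℝ) * sideVec g k).arg, sub_self]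
  simp [sideArc_vel]

theorem extAngle_sideArc {l : ℤ} (hl : sideVec g l = sideVec g (k - 1)) {a' b' : ℝ}
    (hab : b < a) (hab' : b' < a') :
    extAngle (sideArc g hg k a b hab.ne') (sideArc g hg l a' b' hab'.ne') =
      -(2 * Real.pi / (4 * g)) := by
  have hneg (c d : ℝ) (z : ℂ) : (d - c : ℝ) * z = -((c - d : ℝ) * z) := by push_cast; ring
  rw [extAngle, sideArc_vel, sideArc_vel, hl, hneg a', hneg a, neg_div_neg_eq,
    arg_ofReal_mul_div_ofReal_mul (sub_pos.mpr hab') (sub_pos.mpr hab),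
    arg_sideVec_sub_one_div hg]

end Sides

namespace Crossing

variable (x : D.Crossing)

theorem detour_ne_nil : x.detour ≠ [] := by simp [detour]

theorem pair_ne_side : (D.pair x.side : ℕ) ≠ x.side := fun h => D.pair_ne _ (Fin.ext h)

theorem reverse_side : x.reverse.side = D.pair x.side := rfl

theorem pair_reverse_side : D.pair x.reverse.side = x.side := D.pair_pair x.side

theorem sideDir_eq_sideVec : x.sideDir = sideVec D.genus (x.side : ℕ) := rfl

theorem steps_of_pair_lt (h : (D.pair x.side : ℕ) < x.side) :
    x.steps = x.side - D.pair x.side := by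
  have := x.side.2
  rw [steps, Nat.mod_eq_sub_mod (by omega), Nat.mod_eq_of_lt (by omega)]
  omega

theorem steps_of_lt_pair (h : (x.side : ℕ) < D.pair x.side) :
    x.steps = x.side + 4 * D.genus - D.pair x.side := by
  rw [steps, Nat.mod_eq_of_lt (by omega)]

theorem steps_pos : 0 < x.steps := by
  have := (D.pair x.side).2
  rcases lt_or_gt_of_ne x.pair_ne_side with h | h
  · rw [x.steps_of_pair_lt h]; omega
  · rw [x.steps_of_lt_pair h]; omega

theorem steps_add_steps_reverse : x.steps + x.reverse.steps = 4 * D.genus := by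
  have := x.side.2
  have := (D.pair x.side).2
  rcases lt_or_gt_of_ne x.pair_ne_side with h | h
  · rw [x.steps_of_pair_lt h, x.reverse.steps_of_lt_pair (by rwa [pair_reverse_side]),
      pair_reverse_side, reverse_side]; omega
  · rw [x.steps_of_lt_pair h, x.reverse.steps_of_pair_lt (by rwa [pair_reverse_side]),
      pair_reverse_side, reverse_side]; omega

theorem sideVec_pair :
    sideVec D.genus (D.pair x.side : ℕ) = sideVec D.genus ((x.side : ℕ) - (x.steps : ℕ)) := by
  refine sideVec_eq_of_modEq x.genus_pos ?_
  rcases lt_or_gt_of_ne x.pair_ne_side with h | h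
  · rw [x.steps_of_pair_lt h, Nat.cast_sub h.le, sub_sub_cancel]
  · rw [x.steps_of_lt_pair h, Int.modEq_iff_dvd]
    exact ⟨-1, by push_cast [(D.pair x.side).2.le.trans (Nat.le_add_left _ _)]; ring⟩

theorem headVel_detour : headVel x.detour = x.param * -sideVec D.genus (x.side : ℕ) := by
  simp [detour, headVel, sideArc_vel]

theorem lastVel_detour : lastVel x.detour = x.param * -sideVec D.genus (D.pair x.side : ℕ) := by
  rw [detour, lastVel_append _ (by simp)]
  simp [lastVel, sideArc_vel]

theorem turning_of_mem_detour {γ : PlanarArc} (hγ : γ ∈ x.detour) : γ.turning = 0 := by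
  simp only [detour, List.cons_append, List.mem_cons, List.mem_append, List.mem_map,
    List.not_mem_nil, or_false] at hγ
  obtain rfl | ⟨_, _, rfl⟩ | rfl := hγ
  · exact sideArc_turning ..
  · exact sideArc_turning ..
  · exact sideArc_turning ..

theorem isChain_detour :
    x.detour.IsChain fun γ δ => extAngle γ δ = -(2 * Real.pi / (4 * D.genus)) := by
  obtain ⟨n, hn⟩ := Nat.exists_eq_add_one.mpr x.steps_pos
  have hpair := x.sideVec_pair
  have := x.param_pos
  rw [hn] at hpair
  rw [detour, hn, Nat.add_sub_cancel]
  cases n with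
  | zero =>
    simpa using extAngle_sideArc x.genus_pos _ (by simpa using hpair) x.param_pos (by linarith)
  | succ n =>
    simp only [List.cons_append, List.isChain_cons, List.isChain_append, List.isChain_map,
      List.isChain_range_succ, List.head?_append, List.head?_map, List.head?_range,
      List.head?_cons, List.head?_nil, List.getLast?_map, List.getLast?_range, Nat.add_eq_zero_iff,
      one_ne_zero, and_false, ↓reduceIte, Option.map_some, Option.or_some, Option.getD_some,
      Option.mem_def, Option.some.injEq, forall_eq', reduceCtorEq, IsEmpty.forall_iff,
      implies_true, List.IsChain.nil, true_and, Nat.succ_eq_add_one, Nat.add_sub_cancel]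
    refine ⟨extAngle_sideArc _ _ (by simp) x.param_pos one_pos, fun m _ =>
      extAngle_sideArc _ _ (by push_cast; ring_nf) one_pos one_pos,
      extAngle_sideArc _ _ (by rw [hpair]; push_cast; ring_nf) one_pos (by linarith)⟩

theorem length_detour : x.detour.length = x.steps + 1 := by
  have := x.steps_pos
  simp only [detour, List.length_append, List.length_cons, List.length_map, List.length_range,
    List.length_nil]
  omega

theorem pathTurning_detour :
    pathTurning x.detour = -(x.steps * (2 * Real.pi / (4 * D.genus))) := by
  rw [pathTurning_of_isChain_extAngle x.detour_ne_nil (fun _ => x.turning_of_mem_detour)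
    x.isChain_detour, x.length_detour]
  push_cast
  ring

/-- The turning between the velocity `u` before the crossing and the velocity `v` after it, along
the detour and its two end corners. -/
noncomputable def turning (u v : ℂ) : ℝ :=
  (headVel x.detour / u).arg + pathTurning x.detour + (v / lastVel x.detour).arg

theorem turning_eq_add (u v : ℂ) :
    x.turning u v = (-sideVec D.genus (x.side : ℕ) / u).arg -
      x.steps * (2 * Real.pi / (4 * D.genus)) +
      (-v / sideVec D.genus (D.pair x.side : ℕ)).arg := by
  have hhead := arg_ofReal_mul_div_ofReal_mul x.param_pos one_pos
    (-sideVec D.genus (x.side : ℕ)) u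
  have hlast := arg_ofReal_mul_div_ofReal_mul one_pos x.param_pos
    v (-sideVec D.genus (D.pair x.side : ℕ))
  rw [Complex.ofReal_one, one_mul] at hhead hlast
  rw [turning, headVel_detour, lastVel_detour, pathTurning_detour, hhead, hlast, div_neg,
    ← neg_div]
  ring

/-- The two detours go once around the polygon clockwise, and each of the two lines in direction
`u` and `v` is left and entered, which contributes a clockwise half turn. -/
theorem turning_add_turning_reverse {u v : ℂ} (hu : (conj x.sideDir * u).im < 0)
    (hv : 0 < (conj x.reverse.sideDir * v).im) :
    x.turning u v + x.reverse.turning (-v) (-u) = -(4 * Real.pi) := by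
  have hexit := arg_div_add_arg_div_neg (u := -x.sideDir) (t := u) (s := -1) (by
    simp at hu ⊢; linarith)
  have hentry := arg_div_add_arg_div_neg (u := -x.reverse.sideDir) (t := -v) (s := -1) (by
    simp at hv ⊢; linarith)
  have hsteps : (x.steps + x.reverse.steps : ℝ) * (2 * Real.pi / (4 * D.genus)) =
      2 * Real.pi := by
    have hg : (D.genus : ℝ) ≠ 0 := by exact_mod_cast x.genus_pos.ne'
    rw [← Nat.cast_add, x.steps_add_steps_reverse]
    push_cast
    field_simp
  simp only [sideDir_eq_sideVec, reverse_side, neg_neg, Units.val_neg, Units.val_one,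
    Int.cast_neg, Int.cast_one] at hexit hentry
  rw [turning_eq_add, turning_eq_add, pair_reverse_side, reverse_side, neg_neg]
  linarith

end Crossing

namespace Curve

variable (c : D.Curve)

theorem drawn_ne_nil : c.drawn ≠ [] := by simp [drawn]

theorem headVel_drawn : headVel c.drawn = c.startDir := rfl

theorem lastVel_drawn : lastVel c.drawn = c.finishDir := lastVel_joined ..

theorem pathTurning_drawn : pathTurning c.drawn = ∑ k, (c.arc k).turning +
    ∑ k, (c.cross k).turning ((c.arc k.castSucc).vel 1) ((c.arc k.succ).vel 0) :=
  pathTurning_joined c.arc fun k => (c.cross k).detour_ne_nil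

theorem reverse_start : c.reverse.start = c.finish := by
  dsimp only [start, finish, reverse]
  rw [PlanarArc.reverse_start, Fin.rev_zero]

theorem reverse_finish : c.reverse.finish = c.start := by
  simp [start, finish, reverse, PlanarArc.reverse_finish]

theorem reverse_startDir : c.reverse.startDir = -c.finishDir := by
  dsimp only [startDir, finishDir, reverse]
  rw [reverse_vel, sub_zero, Fin.rev_zero]

theorem reverse_finishDir : c.reverse.finishDir = -c.startDir := by
  simp [startDir, finishDir, reverse, reverse_vel]

theorem sum_turning_reverse : ∑ k, (c.reverse.arc k).turning = -∑ k, (c.arc k).turning := by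
  dsimp only [reverse]
  simp only [PlanarArc.reverse_turning, Finset.sum_neg_distrib]
  exact congrArg Neg.neg (Equiv.sum_comp Fin.revPerm fun k => (c.arc k).turning)

theorem sum_crossing_turning_reverse :
    ∑ k, (c.reverse.cross k).turning ((c.reverse.arc k.castSucc).vel 1)
        ((c.reverse.arc k.succ).vel 0) =
      ∑ k, (c.cross k).reverse.turning (-(c.arc k.succ).vel 0) (-(c.arc k.castSucc).vel 1) := by
  dsimp only [reverse]
  simp only [PlanarArc.reverse_vel, Fin.rev_castSucc, Fin.rev_succ, sub_zero, sub_self]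
  exact Equiv.sum_comp Fin.revPerm fun k =>
    (c.cross k).reverse.turning (-(c.arc k.succ).vel 0) (-(c.arc k.castSucc).vel 1)

variable {c} in
theorem pathTurning_drawn_add_reverse (hc : c.IsEmbedded) :
    pathTurning c.drawn + pathTurning c.reverse.drawn = -(4 * Real.pi) * c.num := by
  have hcross : ∑ k, ((c.cross k).turning ((c.arc k.castSucc).vel 1) ((c.arc k.succ).vel 0) +
      (c.cross k).reverse.turning (-(c.arc k.succ).vel 0) (-(c.arc k.castSucc).vel 1)) =
        -(4 * Real.pi) * c.num := by
    simp only [fun k => (c.cross k).turning_add_turning_reverse (hc.exit_transversal k)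
      (hc.entry_transversal k), Finset.sum_const, Finset.card_univ, Fintype.card_fin,
      nsmul_eq_mul]
    ring
  rw [pathTurning_drawn, pathTurning_drawn, sum_turning_reverse, sum_crossing_turning_reverse,
    ← hcross, Finset.sum_add_distrib]
  ring

end Curve

end PuncturedPolygon

/-! ### Arcs covering a circle -/

section CircleCover

open MeasureTheory Pointwise

theorem volume_vadd_smul_Ico (a c : ℝ) :
    volume (a +ᵥ c • Ico (0 : ℝ) 1) = ENNReal.ofReal |c| := by
  rw [measure_vadd, Measure.addHaar_smul, Real.volume_Ico]
  simp

theorem measurableSet_vadd_smul_Ico (a c : ℝ) : MeasurableSet (a +ᵥ c • Ico (0 : ℝ) 1) :=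
  (measurableSet_Ico.const_smul₀ c).const_vadd a

variable {ι : Type*} {T : ℝ} {a c : ι → ℝ}

theorem mem_vadd_smul_Ico {a c x : ℝ} :
    x ∈ a +ᵥ c • Ico (0 : ℝ) 1 ↔ ∃ t ∈ Ico (0 : ℝ) 1, a + c * t = x := by
  simp only [mem_vadd_set, mem_smul_set, exists_exists_and_eq_and, vadd_eq_add, smul_eq_mul]

theorem isAddFundamentalDomain_iUnion_of_existsUnique [Countable ι]
    (h : ∀ x : ℝ, ∃! p : ι × ℝ, p.2 ∈ Ico (0 : ℝ) 1 ∧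
      ((a p.1 + c p.1 * p.2 : ℝ) : AddCircle T) = x) :
    IsAddFundamentalDomain (AddSubgroup.zmultiples T) (⋃ i, a i +ᵥ c i • Ico (0 : ℝ) 1) := by
  refine .mk' (MeasurableSet.iUnion fun i => measurableSet_vadd_smul_Ico _ _).nullMeasurableSet
    fun x => ?_
  obtain ⟨⟨i, t⟩, ⟨ht, hx⟩, huniq⟩ := h x
  have hg : a i + c i * t - x ∈ AddSubgroup.zmultiples T := QuotientAddGroup.eq_iff_sub_mem.mp hx
  refine ⟨⟨_, hg⟩, mem_iUnion.mpr ⟨i, mem_vadd_smul_Ico.mpr ⟨t, ht, ?_⟩⟩, ?_⟩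
  · exact (sub_add_cancel _ _).symm
  · rintro ⟨g, hg⟩ hmem
    obtain ⟨j, hj⟩ := mem_iUnion.mp hmem
    obtain ⟨u, hu, hgx : a j + c j * u = g + x⟩ := mem_vadd_smul_Ico.mp hj
    have hju : ((a j + c j * u : ℝ) : AddCircle T) = x :=
      QuotientAddGroup.eq_iff_sub_mem.mpr (by rwa [hgx, add_sub_cancel_right])
    obtain ⟨rfl, rfl⟩ := Prod.mk.inj (huniq (j, u) ⟨hu, hju⟩)
    exact Subtype.ext (by linarith)

theorem pairwise_disjoint_vadd_smul_Ico
    (h : ∀ x : ℝ, ∃! p : ι × ℝ, p.2 ∈ Ico (0 : ℝ) 1 ∧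
      ((a p.1 + c p.1 * p.2 : ℝ) : AddCircle T) = x) :
    Pairwise (Function.onFun Disjoint fun i => a i +ᵥ c i • Ico (0 : ℝ) 1) := by
  refine fun i j hij => Set.disjoint_left.mpr fun x hi hj => hij ?_
  obtain ⟨t, ht, htx⟩ := mem_vadd_smul_Ico.mp hi
  obtain ⟨u, hu, hux⟩ := mem_vadd_smul_Ico.mp hj
  exact congrArg Prod.fst ((h x).unique (y₁ := (i, t)) (y₂ := (j, u))
    ⟨ht, congrArg _ htx⟩ ⟨hu, congrArg _ hux⟩)

theorem sum_abs_eq_of_existsUnique [Fintype ι] (hT : 0 < T)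
    (h : ∀ x : ℝ, ∃! p : ι × ℝ, p.2 ∈ Ico (0 : ℝ) 1 ∧
      ((a p.1 + c p.1 * p.2 : ℝ) : AddCircle T) = x) :
    ∑ i, |c i| = T := by
  have hvol := (isAddFundamentalDomain_iUnion_of_existsUnique h).measure_eq
    (isAddFundamentalDomain_Ioc hT 0 volume)
  rw [measure_iUnion (pairwise_disjoint_vadd_smul_Ico h)
    fun i => measurableSet_vadd_smul_Ico _ _, tsum_fintype, Real.volume_Ioc] at hvol
  simp only [volume_vadd_smul_Ico] at hvol
  rw [← ENNReal.ofReal_sum_of_nonneg fun i _ => abs_nonneg (c i), zero_add, sub_zero] at hvol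
  exact (ENNReal.ofReal_eq_ofReal_iff (Finset.sum_nonneg fun i _ => abs_nonneg (c i)) hT.le).mp
    hvol

end CircleCover

/-! ### Boundary circles -/

open PlanarArc PuncturedPolygon

namespace PuncturedPolygon

variable {D : PuncturedPolygon}

namespace Component

variable (c : D.Component) (σ : ℤˣ)

/-- The sign of a boundary component, as a unit. -/
noncomputable def signUnit : ℤˣ := c.1.elim 1 fun _ => -1

theorem coe_signUnit : ((c.signUnit : ℤ) : ℝ) = c.sign := by
  rcases c with ⟨_ | h, hc⟩ <;> simp [signUnit, sign]

theorem coe_mul_signUnit : (((σ * c.signUnit : ℤˣ) : ℤ) : ℝ) = ((σ : ℤ) : ℝ) * c.sign := by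
  rw [Units.val_mul, Int.cast_mul, coe_signUnit]

/-- The tangent vector at `z` of the boundary circle `c`, traversed with the surface to its left if
`σ = 1` and to its right if `σ = -1`. -/
noncomputable def tangent (z : ℂ) : ℂ :=
  (((σ : ℤ) : ℝ) * c.sign : ℝ) * (Complex.I * (z - c.center))

variable {c} in
theorem orient_mul_im_conj_tangent_mul {z u : ℂ} (h : c.PointsInward z u) :
    0 < ((σ : ℤ) : ℝ) * (conj (c.tangent σ z) * u).im := by
  have hσ : ((σ : ℤ) : ℝ) * (σ : ℤ) = 1 := by exact_mod_cast Int.units_coe_mul_self σ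
  calc 0 < (((σ : ℤ) : ℝ) * (σ : ℤ)) * -(c.sign * (conj (z - c.center) * u).re) := by
        rw [hσ, one_mul]
        exact neg_pos.mpr h
    _ = ((σ : ℤ) : ℝ) * (conj (c.tangent σ z) * u).im := by
        simp [tangent]
        ring

theorem disjoint_hole_unitSphere (hg : D.genus = 0) (k : Fin D.holes) :
    Disjoint (Metric.closedBall (D.center k) (D.radius k)) (Metric.sphere 0 1) := by
  have hk := D.hole_subset k
  rw [openFace, if_pos hg] at hk
  exact Metric.sphere_disjoint_ball.symm.mono_left hk

theorem eq_of_mem_circle {c c' : D.Component} {z : ℂ} (h : z ∈ c.circle)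
    (h' : z ∈ c'.circle) : c = c' := by
  rcases c with ⟨_ | k, hc⟩ <;> rcases c' with ⟨_ | k', hc'⟩
  · rfl
  · exact absurd h (Set.disjoint_left.mp (disjoint_hole_unitSphere (hc rfl) k')
      (Metric.sphere_subset_closedBall h'))
  · exact absurd h' (Set.disjoint_left.mp (disjoint_hole_unitSphere (hc' rfl) k)
      (Metric.sphere_subset_closedBall h))
  · obtain rfl : k = k' := by
      by_contra hne
      exact Set.disjoint_left.mp (D.hole_disjoint k k' hne) (Metric.sphere_subset_closedBall h)
        (Metric.sphere_subset_closedBall h')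
    rfl

theorem center_add_radius_mul_exp_mem_circle (θ : ℝ) :
    c.center + c.radius * Complex.exp (θ * Complex.I) ∈ c.circle := by
  simp [circle, mem_sphere_iff_norm, Complex.norm_exp_ofReal_mul_I, abs_of_pos c.radius_pos]

end Component

section CircleArc

variable (σ : ℤˣ) (c : D.Component) (a ℓ : ℝ) (hℓ : 0 < ℓ)

theorem circleArc_apply (t : ℝ) : (circleArc σ c a ℓ hℓ).toFun t = c.center +
    c.radius * Complex.exp ((a + ((σ : ℤ) : ℝ) * c.sign * ℓ * t : ℝ) * Complex.I) := rfl

theorem circleArc_mem_circle (t : ℝ) : (circleArc σ c a ℓ hℓ).toFun t ∈ c.circle :=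
  c.center_add_radius_mul_exp_mem_circle _

theorem circleArc_apply_eq_iff (t θ : ℝ) :
    (circleArc σ c a ℓ hℓ).toFun t = c.center + c.radius * Complex.exp (θ * Complex.I) ↔
      ((a + ((σ : ℤ) : ℝ) * c.sign * ℓ * t : ℝ) : Real.Angle) = θ := by
  have hr : (c.radius : ℂ) ≠ 0 := by exact_mod_cast c.radius_pos.ne'
  rw [circleArc_apply, add_right_inj, mul_right_inj' hr, ← Circle.coe_exp, ← Circle.coe_exp,
    Circle.coe_inj, ← Real.Angle.toCircle_coe, ← Real.Angle.toCircle_coe]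
  exact (Function.LeftInverse.injective (g := fun z : Circle => ((z : ℂ).arg : Real.Angle))
    Real.Angle.arg_toCircle).eq_iff

theorem circleArc_vel (t : ℝ) : (circleArc σ c a ℓ hℓ).vel t =
    ℓ * c.tangent σ ((circleArc σ c a ℓ hℓ).toFun t) := by
  have hangle : HasDerivAt (fun t : ℝ => a + ((σ : ℤ) : ℝ) * c.sign * ℓ * t)
      (((σ : ℤ) : ℝ) * c.sign * ℓ) t := by
    simpa using ((hasDerivAt_id t).const_mul (((σ : ℤ) : ℝ) * c.sign * ℓ)).const_add a
  refine ((((hangle.ofReal_comp).mul_const Complex.I).cexp.const_mul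
    (c.radius : ℂ)).const_add c.center).deriv.trans ?_
  rw [Component.tangent, circleArc_apply]
  push_cast
  ring

theorem circleArc_turning : (circleArc σ c a ℓ hℓ).turning = ((σ : ℤ) : ℝ) * c.sign * ℓ := by
  have hvel (t : ℝ) : (circleArc σ c a ℓ hℓ).vel t = ((ℓ * c.radius : ℝ) : ℂ) *
      ((((σ : ℤ) : ℝ) * c.sign : ℝ) * Complex.I *
        Complex.exp ((a + ((σ : ℤ) : ℝ) * c.sign * ℓ * t : ℝ) * Complex.I)) := by
    rw [circleArc_vel, Component.tangent, circleArc_apply]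
    push_cast
    ring
  have hdir : ((((σ : ℤ) : ℝ) * c.sign : ℝ) : ℂ) * Complex.I ≠ 0 := by
    rw [← c.coe_mul_signUnit]
    simp
  rw [turning_eq _ (θ := fun t => a + ((σ : ℤ) : ℝ) * c.sign * ℓ * t) (by fun_prop)
    ((((((σ : ℤ) : ℝ) * c.sign : ℝ) : ℂ) * Complex.I).arg : Real.Angle)]
  · ring
  · intro t _
    rw [hvel, Complex.arg_real_mul _ (mul_pos hℓ c.radius_pos),
      Complex.arg_mul_coe_angle hdir (Complex.exp_ne_zero _), Complex.arg_exp_mul_I,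
      Real.Angle.coe_toIocMod, add_comm]

end CircleArc

open Classical in
/-- The tangent vector at `z` of the boundary circle through `z`, traversed with the surface to its
left if `σ = 1` and to its right if `σ = -1`; junk if `z` is not a boundary point. -/
noncomputable def tangent (D : PuncturedPolygon) (σ : ℤˣ) (z : ℂ) : ℂ :=
  if h : ∃ c : D.Component, z ∈ c.circle then h.choose.tangent σ z else 0

theorem tangent_eq {c : D.Component} (σ : ℤˣ) {z : ℂ} (h : z ∈ c.circle) :
    D.tangent σ z = c.tangent σ z := by
  have hex : ∃ c : D.Component, z ∈ c.circle := ⟨c, h⟩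
  rw [tangent, dif_pos hex, Component.eq_of_mem_circle hex.choose_spec h]

theorem arg_tangent_corners {c : D.Component} (σ : ℤˣ) {z u : ℂ} (hz : z ∈ c.circle)
    (h : c.PointsInward z u) :
    (u / D.tangent σ z).arg + (D.tangent σ z / -u).arg = ((σ : ℤ) : ℝ) * Real.pi := by
  rw [tangent_eq σ hz]
  exact arg_div_add_arg_div_neg (Component.orient_mul_im_conj_tangent_mul σ h)

noncomputable instance : Fintype D.Component := by
  classical
  exact inferInstanceAs (Fintype {o : Option (Fin D.holes) // o = none → D.genus = 0})

theorem card_component (D : PuncturedPolygon) : Fintype.card D.Component = D.numComponents := by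
  classical
  change Fintype.card {o : Option (Fin D.holes) // o = none → D.genus = 0} = _
  rw [numComponents]
  split_ifs with hg
  · simp [Fintype.card_congr (Equiv.subtypeUnivEquiv fun _ _ => hg)]
  · simp [hg]

theorem numComponents_pos (D : PuncturedPolygon) : 0 < D.numComponents := by
  rw [numComponents]
  rcases D.has_boundary with h | h
  · simp [h]
  · omega

end PuncturedPolygon

/-! ### The boundary of the cut surface -/

namespace BoundaryPiece

variable {D : PuncturedPolygon} (cuts : Fin (D.numComponents - 1) → D.Curve) (σ : ℤˣ)

theorem drawn_ne_nil (p : BoundaryPiece D) : p.drawn cuts σ ≠ [] := by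
  cases p with
  | arc => exact List.cons_ne_nil _ _
  | cut k rev => exact Curve.drawn_ne_nil _

/-- The exterior angle at the start of a piece, as seen from the boundary circle. -/
noncomputable def entryAngle (p : BoundaryPiece D) : ℝ :=
  (headVel (p.drawn cuts σ) / D.tangent σ (p.start cuts σ)).arg

/-- The exterior angle at the finish of a piece, as seen from the boundary circle. -/
noncomputable def exitAngle (p : BoundaryPiece D) : ℝ :=
  (D.tangent σ (p.finish cuts σ) / lastVel (p.drawn cuts σ)).arg

variable {cuts σ}

theorem exists_headVel_eq {p : BoundaryPiece D} (hp : ¬ p.IsCut) :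
    ∃ ℓ : ℝ, 0 < ℓ ∧ headVel (p.drawn cuts σ) = ℓ * D.tangent σ (p.start cuts σ) := by
  cases p with
  | arc c a ℓ hℓ =>
    exact ⟨ℓ, hℓ, (circleArc_vel σ c a ℓ hℓ 0).trans
      (by rw [← tangent_eq σ (circleArc_mem_circle σ c a ℓ hℓ 0)]; rfl)⟩
  | cut => exact absurd trivial hp

theorem exists_lastVel_eq {p : BoundaryPiece D} (hp : ¬ p.IsCut) :
    ∃ ℓ : ℝ, 0 < ℓ ∧ lastVel (p.drawn cuts σ) = ℓ * D.tangent σ (p.finish cuts σ) := by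
  cases p with
  | arc c a ℓ hℓ =>
    exact ⟨ℓ, hℓ, (circleArc_vel σ c a ℓ hℓ 1).trans
      (by rw [← tangent_eq σ (circleArc_mem_circle σ c a ℓ hℓ 1)]; rfl)⟩
  | cut => exact absurd trivial hp

theorem entryAngle_of_not_isCut {p : BoundaryPiece D} (hp : ¬ p.IsCut) :
    p.entryAngle cuts σ = 0 := by
  obtain ⟨ℓ, hℓ, hvel⟩ := exists_headVel_eq (cuts := cuts) (σ := σ) hp
  have hne := headVel_ne_zero (p.drawn cuts σ)
  rw [hvel] at hne
  rw [entryAngle, hvel, mul_div_cancel_right₀ _ (right_ne_zero_of_mul hne),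
    Complex.arg_ofReal_of_nonneg hℓ.le]

theorem exitAngle_of_not_isCut {p : BoundaryPiece D} (hp : ¬ p.IsCut) :
    p.exitAngle cuts σ = 0 := by
  obtain ⟨ℓ, hℓ, hvel⟩ := exists_lastVel_eq (cuts := cuts) (σ := σ) hp
  have hne := lastVel_ne_zero (p.drawn cuts σ)
  rw [hvel] at hne
  rw [exitAngle, hvel, div_mul_cancel_right₀ (right_ne_zero_of_mul hne), ← Complex.ofReal_inv,
    Complex.arg_ofReal_of_nonneg (inv_nonneg.mpr hℓ.le)]

theorem cornerAngle_eq {p p' : BoundaryPiece D} (hjoin : p.finish cuts σ = p'.start cuts σ)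
    (halt : ¬ (p.IsCut ∧ p'.IsCut)) :
    cornerAngle (p.drawn cuts σ) (p'.drawn cuts σ) =
      p.exitAngle cuts σ + p'.entryAngle cuts σ := by
  rcases not_and_or.mp halt with hp | hp'
  · obtain ⟨ℓ, hℓ, hvel⟩ := exists_lastVel_eq (cuts := cuts) (σ := σ) hp
    rw [exitAngle_of_not_isCut hp, zero_add, cornerAngle, entryAngle, hvel, hjoin]
    simpa using arg_ofReal_mul_div_ofReal_mul one_pos hℓ (headVel (p'.drawn cuts σ)) _
  · obtain ⟨ℓ, hℓ, hvel⟩ := exists_headVel_eq (cuts := cuts) (σ := σ) hp'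
    rw [entryAngle_of_not_isCut hp', add_zero, cornerAngle, exitAngle, hvel, hjoin]
    simpa using arg_ofReal_mul_div_ofReal_mul hℓ one_pos _ (lastVel (p.drawn cuts σ))

variable (cuts σ) in
/-- The turning of a piece together with its exterior angles against the boundary circles. -/
noncomputable def totalTurning (p : BoundaryPiece D) : ℝ :=
  p.entryAngle cuts σ + pathTurning (p.drawn cuts σ) + p.exitAngle cuts σ

theorem totalTurning_arc (c : D.Component) (a ℓ : ℝ) (hℓ : 0 < ℓ) :
    (arc c a ℓ hℓ).totalTurning cuts σ = ((σ : ℤ) : ℝ) * c.sign * ℓ := by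
  rw [totalTurning, entryAngle_of_not_isCut id, exitAngle_of_not_isCut id]
  simp [drawn, pathTurning, circleArc_turning]

theorem entryAngle_cut_add_exitAngle_cut_not {k : Fin (D.numComponents - 1)} {rev : Bool}
    {c : D.Component} (hmem : (cutCurve cuts k rev).start ∈ c.circle)
    (hin : c.PointsInward (cutCurve cuts k rev).start (cutCurve cuts k rev).startDir) :
    (cut k rev).entryAngle cuts σ + (cut k !rev).exitAngle cuts σ = ((σ : ℤ) : ℝ) * Real.pi := by
  have hfinish : (cutCurve cuts k !rev).finish = (cutCurve cuts k rev).start := by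
    cases rev <;> simp [cutCurve, Curve.reverse_start, Curve.reverse_finish]
  have hdir : (cutCurve cuts k !rev).finishDir = -(cutCurve cuts k rev).startDir := by
    cases rev <;> simp [cutCurve, Curve.reverse_startDir, Curve.reverse_finishDir]
  rw [entryAngle, exitAngle, drawn, drawn, Curve.headVel_drawn, Curve.lastVel_drawn, start, finish,
    hfinish, hdir]
  exact arg_tangent_corners σ hmem hin

/-- The component of a boundary arc, or the index and the direction of a cut. -/
def support : BoundaryPiece D → D.Component ⊕ (Fin (D.numComponents - 1) × Bool)
  | arc c _ _ _ => .inl c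
  | cut k rev => .inr (k, rev)

theorem support_eq_inl_iff {p : BoundaryPiece D} {c : D.Component} :
    p.support = .inl c ↔ ∃ a ℓ hℓ, p = arc c a ℓ hℓ := by
  cases p with
  | arc c' a ℓ hℓ => simp [support, hℓ]
  | cut => simp [support]

theorem support_eq_inr_iff {p : BoundaryPiece D} {x : Fin (D.numComponents - 1) × Bool} :
    p.support = .inr x ↔ p = cut x.1 x.2 := by
  cases p <;> simp [support, Prod.ext_iff]

end BoundaryPiece

namespace CutSurface

variable {D : PuncturedPolygon} {V E : Type*} {N : Network D V E} (T : CutSurface N)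

theorem exists_pointsInward_cutCurve (k : Fin (D.numComponents - 1)) (rev : Bool) :
    ∃ c : D.Component, (BoundaryPiece.cutCurve T.cuts k rev).start ∈ c.circle ∧
      c.PointsInward (BoundaryPiece.cutCurve T.cuts k rev).start
        (BoundaryPiece.cutCurve T.cuts k rev).startDir := by
  obtain ⟨c, c', -, hstart, hfinish, hin, hout⟩ := T.cuts_ends k
  cases rev with
  | false => exact ⟨c, hstart, hin⟩
  | true =>
    refine ⟨c', ?_⟩
    simpa only [BoundaryPiece.cutCurve, if_true, Curve.reverse_start, Curve.reverse_startDir]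
      using ⟨hfinish, hout⟩

theorem sum_totalTurning_cut (k : Fin (D.numComponents - 1)) :
    ∑ rev, (BoundaryPiece.cut k rev).totalTurning T.cuts T.orient =
      2 * Real.pi * (((T.orient : ℤ) : ℝ) - 2 * (T.cuts k).num) := by
  obtain ⟨c, hc, hcin⟩ := T.exists_pointsInward_cutCurve k false
  obtain ⟨c', hc', hcin'⟩ := T.exists_pointsInward_cutCurve k true
  have hstart := BoundaryPiece.entryAngle_cut_add_exitAngle_cut_not (σ := T.orient) hc hcin
  have hfinish := BoundaryPiece.entryAngle_cut_add_exitAngle_cut_not (σ := T.orient) hc' hcin'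
  have hturn : pathTurning ((BoundaryPiece.cut k false).drawn T.cuts T.orient) +
      pathTurning ((BoundaryPiece.cut k true).drawn T.cuts T.orient) =
        -(4 * Real.pi) * (T.cuts k).num :=
    Curve.pathTurning_drawn_add_reverse (T.cuts_embedded k)
  rw [Fintype.sum_bool, BoundaryPiece.totalTurning, BoundaryPiece.totalTurning]
  simp only [Bool.not_false, Bool.not_true] at hstart hfinish
  linarith

theorem existsUnique_arc_angle {c : D.Component}
    {a ℓ : {m // (T.piece m).support = .inl c} → ℝ} {hℓ : ∀ m, 0 < ℓ m}
    (hpiece : ∀ m, T.piece m.1 = .arc c (a m) (ℓ m) (hℓ m)) (θ : ℝ) :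
    ∃! p : {m // (T.piece m).support = .inl c} × ℝ, p.2 ∈ Ico (0 : ℝ) 1 ∧
      ((a p.1 + ((T.orient : ℤ) : ℝ) * c.sign * ℓ p.1 * p.2 : ℝ) : Real.Angle) = θ := by
  obtain ⟨⟨m, t⟩, ⟨ht, a', ℓ', hℓ', hm, hz⟩, huniq⟩ :=
    T.circle_once c _ (c.center_add_radius_mul_exp_mem_circle θ)
  have hsupp : (T.piece m).support = .inl c :=
    BoundaryPiece.support_eq_inl_iff.mpr ⟨a', ℓ', hℓ', hm⟩
  refine ⟨(⟨m, hsupp⟩, t), ⟨ht, (circleArc_apply_eq_iff _ _ _ _ (hℓ _) _ _).mp ?_⟩, ?_⟩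
  · obtain ⟨-, rfl, rfl⟩ := BoundaryPiece.arc.inj (hm.symm.trans (hpiece ⟨m, hsupp⟩))
    exact hz
  · rintro ⟨m', t'⟩ ⟨ht', hθ⟩
    obtain ⟨hm', rfl⟩ := Prod.mk.inj (huniq (m', t')
      ⟨ht', _, _, hℓ m', hpiece m', (circleArc_apply_eq_iff ..).mpr hθ⟩)
    exact Prod.ext (Subtype.ext hm') rfl

open Classical in
theorem sum_support_eq_inl {f : BoundaryPiece D → ℝ} {s : ℝ} {c : D.Component}
    (hf : ∀ a ℓ hℓ, f (.arc c a ℓ hℓ) = s * ℓ) :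
    ∑ m with (T.piece m).support = .inl c, f (T.piece m) = s * (2 * Real.pi) := by
  choose a ℓ hℓ hpiece using fun m : {m // (T.piece m).support = .inl c} =>
    BoundaryPiece.support_eq_inl_iff.mp m.2
  have habs (m) : |((T.orient : ℤ) : ℝ) * c.sign * ℓ m| = ℓ m := by
    rw [← c.coe_mul_signUnit, abs_mul, ← Int.cast_abs, Int.isUnit_iff_abs_eq.mp (Units.isUnit _),
      Int.cast_one, one_mul, abs_of_pos (hℓ m)]
  have hlength : ∑ m, ℓ m = 2 * Real.pi := by
    simpa only [habs] using sum_abs_eq_of_existsUnique (a := a)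
      (c := fun m => ((T.orient : ℤ) : ℝ) * c.sign * ℓ m) Real.two_pi_pos
      (T.existsUnique_arc_angle hpiece)
  rw [Finset.sum_subtype (p := fun m => (T.piece m).support = .inl c) _ (by simp), ← hlength,
    Finset.mul_sum]
  exact Finset.sum_congr rfl fun m _ => by rw [hpiece, hf]

open Classical in
theorem sum_support_eq_inr (f : BoundaryPiece D → ℝ) (x : Fin (D.numComponents - 1) × Bool) :
    ∑ m with (T.piece m).support = .inr x, f (T.piece m) = f (.cut x.1 x.2) := by
  obtain ⟨m, hm, huniq⟩ := T.cut_once x.1 x.2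
  have : Finset.univ.filter (fun m => (T.piece m).support = .inr x) = {m} := by
    ext m'
    simp only [BoundaryPiece.support_eq_inr_iff, Finset.mem_filter, Finset.mem_univ, true_and,
      Finset.mem_singleton]
    exact ⟨huniq m', fun h => h ▸ hm⟩
  rw [this, Finset.sum_singleton, hm]

theorem sum_totalTurning : ∑ m, (T.piece m).totalTurning T.cuts T.orient =
    2 * Real.pi * (∑ c : D.Component, ((T.orient : ℤ) : ℝ) * c.sign +
      ∑ k, (((T.orient : ℤ) : ℝ) - 2 * (T.cuts k).num)) := by
  classical
  rw [← Finset.sum_fiberwise Finset.univ fun m => (T.piece m).support, Fintype.sum_sum_type,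
    Fintype.sum_prod_type, mul_add, Finset.mul_sum, Finset.mul_sum]
  congr 1
  · refine Finset.sum_congr rfl fun c _ => ?_
    rw [T.sum_support_eq_inl (BoundaryPiece.totalTurning_arc c), mul_comm]
  · refine Finset.sum_congr rfl fun k _ => ?_
    simp only [T.sum_support_eq_inr, T.sum_totalTurning_cut]

/-- The pieces of the boundary, numbered periodically. -/
def cyclicPiece (m : ℕ) : BoundaryPiece D := T.piece ⟨m % T.len, Nat.mod_lt _ T.len_pos⟩

/-- The pieces of the boundary as curves in the plane, numbered periodically. -/
noncomputable def cyclicDrawn (m : ℕ) : List PlanarArc :=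
  (T.cyclicPiece m).drawn T.cuts T.orient

theorem cyclicPiece_periodic : Function.Periodic T.cyclicPiece T.len := fun m => by
  simp [cyclicPiece]

theorem cyclicPiece_val (m : Fin T.len) : T.cyclicPiece m = T.piece m := by
  simp [cyclicPiece, Nat.mod_eq_of_lt m.2]

theorem cyclicDrawn_ne_nil (m : ℕ) : T.cyclicDrawn m ≠ [] := BoundaryPiece.drawn_ne_nil _ _ _

theorem cyclicDrawn_periodic : Function.Periodic T.cyclicDrawn T.len :=
  T.cyclicPiece_periodic.comp _

theorem cornerAngle_cyclicDrawn (m : ℕ) :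
    cornerAngle (T.cyclicDrawn m) (T.cyclicDrawn (m + 1)) =
      (T.cyclicPiece m).exitAngle T.cuts T.orient +
        (T.cyclicPiece (m + 1)).entryAngle T.cuts T.orient :=
  BoundaryPiece.cornerAngle_eq (T.piece_joins _ _ (by simp)) (T.piece_alternates _ _ (by simp))

theorem startAngle_len_sub_startAngle_zero :
    startAngle T.cyclicDrawn T.len - startAngle T.cyclicDrawn 0 =
      ∑ m, (T.piece m).totalTurning T.cuts T.orient := by
  have hshift : ∑ m ∈ Finset.range T.len, (T.cyclicPiece (m + 1)).entryAngle T.cuts T.orient =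
      ∑ m ∈ Finset.range T.len, (T.cyclicPiece m).entryAngle T.cuts T.orient := by
    rw [← sub_eq_zero, ← Finset.sum_sub_distrib,
      Finset.sum_range_sub fun m => (T.cyclicPiece m).entryAngle T.cuts T.orient,
      T.cyclicPiece_periodic.eq, sub_self]
  simp only [← T.cyclicPiece_val]
  rw [startAngle_sub_startAngle_zero, Fin.sum_univ_eq_sum_range
    fun m => (T.cyclicPiece m).totalTurning T.cuts T.orient]
  simp only [cornerAngle_cyclicDrawn, BoundaryPiece.totalTurning, Finset.sum_add_distrib, hshift]
  simp only [cyclicDrawn]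
  ring

theorem exists_odd_startAngle_len_sub :
    ∃ R : ℤ, Odd R ∧ startAngle T.cyclicDrawn T.len - startAngle T.cyclicDrawn 0 =
      2 * Real.pi * R := by
  refine ⟨∑ c : D.Component, ((T.orient * c.signUnit : ℤˣ) : ℤ) +
    ∑ k, ((T.orient : ℤ) - 2 * (T.cuts k).num), ?_, ?_⟩
  · rw [← ZMod.intCast_eq_one_iff_odd]
    have hunit (u : ℤˣ) : ((u : ℤ) : ZMod 2) = 1 := by
      rcases Int.units_eq_one_or u with rfl | rfl <;> rfl
    obtain ⟨b, hb⟩ := Nat.exists_eq_add_of_lt D.numComponents_pos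
    simp [hunit, card_component, hb, CharTwo.two_eq_zero, add_right_comm, CharTwo.add_self_eq_zero]
  · rw [startAngle_len_sub_startAngle_zero, sum_totalTurning]
    simp only [← Component.coe_mul_signUnit]
    push_cast
    rfl

end CutSurface

/-! ### Tangent angles of a network -/

theorem coe_add_arg_div {z w : ℂ} (hz : z ≠ 0) (hw : w ≠ 0) {α : ℝ}
    (hα : (α : Real.Angle) = z.arg) : ((α + (w / z).arg : ℝ) : Real.Angle) = w.arg := by
  rw [Real.Angle.coe_add, hα, Complex.arg_div_coe_angle hw hz, add_sub_cancel]

theorem coe_sub_arg_div {z w : ℂ} (hz : z ≠ 0) (hw : w ≠ 0) {β : ℝ}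
    (hβ : (β : Real.Angle) = w.arg) : ((β - (w / z).arg : ℝ) : Real.Angle) = z.arg := by
  rw [Real.Angle.coe_sub, hβ, Complex.arg_div_coe_angle hw hz, sub_sub_cancel]

/-- This is where perfect orientation enters: with several incoming and several outgoing
directions, the exterior angles between them need not be differences of lifts. -/
theorem exists_arg_div_eq_sub {ι : Type*} {z w : ι → ℂ} (hz : ∀ a, z a ≠ 0) (hw : ∀ b, w b ≠ 0)
    {A B : Set ι} (h : A.Subsingleton ∨ B.Subsingleton) :
    ∃ α β : ι → ℝ, (∀ a, (α a : Real.Angle) = (z a).arg) ∧ (∀ b, (β b : Real.Angle) = (w b).arg) ∧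
      ∀ a ∈ A, ∀ b ∈ B, (w b / z a).arg = β b - α a := by
  rcases h with hA | hB
  · rcases hA.eq_empty_or_singleton with rfl | ⟨a, rfl⟩
    · exact ⟨fun a => (z a).arg, fun b => (w b).arg, fun _ => rfl, fun _ => rfl, by simp⟩
    · exact ⟨fun a => (z a).arg, fun b => (z a).arg + (w b / z a).arg, fun _ => rfl,
        fun b => coe_add_arg_div (hz a) (hw b) rfl, by simp⟩
  · rcases hB.eq_empty_or_singleton with rfl | ⟨b, rfl⟩
    · exact ⟨fun a => (z a).arg, fun b => (w b).arg, fun _ => rfl, fun _ => rfl, by simp⟩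
    · exact ⟨fun a => (w b).arg - (w b / z a).arg, fun b => (w b).arg,
        fun a => coe_sub_arg_div (hz a) (hw b) rfl, fun _ => rfl, by simp⟩

namespace Network

variable {D : PuncturedPolygon} {V E : Type*} {N : Network D V E}

variable (N) in
/-- Perfect orientation without the valency condition: no path passes through a boundary vertex,
and every interior vertex has at most one incoming or at most one outgoing edge. -/
structure IsPerfect : Prop where
  src_notMem_K : ∀ e f, N.tgt e = N.src f → N.src f ∉ N.K
  subsingleton_or : ∀ v ∉ N.K, {e | N.tgt e = v}.Subsingleton ∨ {e | N.src e = v}.Subsingleton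

theorem PerfectlyOriented.isPerfect [Finite E] (hN : N.PerfectlyOriented) : N.IsPerfect where
  src_notMem_K e f h hK := by
    have hin : 0 < N.inDegree (N.src f) := (Set.ncard_pos (Set.toFinite _)).mpr ⟨e, h⟩
    have hout : 0 < N.outDegree (N.src f) := (Set.ncard_pos (Set.toFinite _)).mpr ⟨f, rfl⟩
    have := hN.1 _ hK
    omega
  subsingleton_or v hv := by
    have hone : N.inDegree v ≤ 1 ∨ N.outDegree v ≤ 1 := by
      have := hN.2 v hv
      omega
    exact hone.imp Set.ncard_le_one_iff_subsingleton.mp Set.ncard_le_one_iff_subsingleton.mp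

variable {i j : V} {P : List E}

theorem IsPath.isChain : ∀ {P : List E} {i : V}, N.IsPath i P j →
    P.IsChain fun e f => N.tgt e = N.src f
  | [], _, _ => .nil
  | [_], _, _ => .singleton _
  | _ :: _ :: _, _, ⟨_, h⟩ => .cons_cons h.1.symm (isChain h)

theorem IsPath.src_head (h : N.IsPath i P j) (hP : P ≠ []) : N.src (P.head hP) = i := by
  cases P with
  | nil => exact absurd rfl hP
  | cons => exact h.1

theorem IsPath.tgt_getLast : ∀ {P : List E} {i : V}, N.IsPath i P j → ∀ hP : P ≠ [],
    N.tgt (P.getLast hP) = j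
  | [], _, _, hP => absurd rfl hP
  | [_], _, h, _ => h.2
  | _ :: f :: Q, _, h, _ => by
    rw [List.getLast_cons (List.cons_ne_nil f Q)]
    exact tgt_getLast h.2 _

theorem IsPath.prod_map_mul {M : Type*} [CommMonoid M] {a b : V → M}
    (hab : ∀ e f, N.tgt e = N.src f → b (N.tgt e) * a (N.src f) = 1) (x : E → M) :
    ∀ {P : List E} {i : V}, N.IsPath i P j → P ≠ [] →
      (P.map fun e => x e * a (N.src e) * b (N.tgt e)).prod = (P.map x).prod * a i * b j
  | [], _, _, hP => absurd rfl hP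
  | [_], _, ⟨hsrc, htgt⟩, _ => by
    obtain rfl := hsrc
    obtain rfl := htgt
    simp
  | e :: f :: Q, _, ⟨hsrc, h⟩, _ => by
    obtain rfl := hsrc
    rw [List.map_cons, List.prod_cons, prod_map_mul hab x h (List.cons_ne_nil f Q),
      List.map_cons (f := x) (a := e), List.prod_cons]
    have hcancel := hab e f h.1.symm
    rw [h.1] at hcancel
    calc x e * a (N.src e) * b (N.tgt e) * (((f :: Q).map x).prod * a (N.tgt e) * b j)
        = x e * ((f :: Q).map x).prod * a (N.src e) * b j * (b (N.tgt e) * a (N.tgt e)) := by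
          ac_rfl
      _ = x e * ((f :: Q).map x).prod * a (N.src e) * b j := by rw [hcancel, mul_one]

theorem Path.wt_C_mul (P : N.Path i j) (ε : E → ℝ) (y : E → MvPowerSeries E ℝ) :
    P.wt (fun e => MvPowerSeries.C (ε e) * y e) = (P.1.map ε).prod • P.wt y := by
  rw [MvPowerSeries.smul_eq_C_mul, wt, wt, List.prod_map_mul, map_list_prod, List.map_map]
  rfl

end Network

namespace CutSurface

variable {D : PuncturedPolygon} {V E : Type*} {N : Network D V E} (T : CutSurface N)

/-- A lift of the argument of the velocity with which the boundary of the cut surface reaches the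
piece `m`. The previous piece is number `m + (len - 1)`, so that `m = 0` needs no exception. -/
noncomputable def arrivalAngle (m : ℕ) : ℝ :=
  startAngle T.cyclicDrawn m - cornerAngle (T.cyclicDrawn (m + (T.len - 1))) (T.cyclicDrawn m)

theorem coe_arrivalAngle (m : ℕ) : (T.arrivalAngle m : Real.Angle) =
    (lastVel (T.cyclicDrawn (m + (T.len - 1)))).arg :=
  coe_sub_arg_div (lastVel_ne_zero _) (headVel_ne_zero _) (coe_startAngle _ _)

/-- Lifts of the arguments of the velocities at the ends of the edges, such that the exterior
angle between consecutive edges is the difference of the lifts, and so is the exterior angle between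
an edge and the boundary of the cut surface. `turns e` compares the lifts with the turning along
the edge `e`. -/
structure TangentAngles where
  start : E → ℝ
  finish : E → ℝ
  turns : E → ℤ
  pathTurning_drawn : ∀ e, pathTurning (N.curve e).drawn =
    finish e - start e + 2 * Real.pi * turns e
  cornerAngle_drawn : ∀ e f, N.tgt e = N.src f →
    cornerAngle (N.curve e).drawn (N.curve f).drawn = start f - finish e
  cornerAngle_source : ∀ (i : N.K) e, N.src e = i →
    cornerAngle (T.cyclicDrawn (T.place i + (T.len - 1))) (N.curve e).drawn =
      start e - T.arrivalAngle (T.place i)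
  cornerAngle_sink : ∀ (j : N.K) e, N.tgt e = j →
    cornerAngle (N.curve e).drawn (T.cyclicDrawn (T.place j)) =
      startAngle T.cyclicDrawn (T.place j) - finish e

theorem exists_vertex_angles (hN : N.IsPerfect) (v : V) :
    ∃ α β : E → ℝ, (∀ e, (α e : Real.Angle) = (lastVel (N.curve e).drawn).arg) ∧
      (∀ e, (β e : Real.Angle) = (headVel (N.curve e).drawn).arg) ∧
      (∀ e f, N.tgt e = v → N.src f = v →
        cornerAngle (N.curve e).drawn (N.curve f).drawn = β f - α e) ∧
      ∀ k : N.K, k = v → ∀ e,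
        cornerAngle (T.cyclicDrawn (T.place k + (T.len - 1))) (N.curve e).drawn =
          β e - T.arrivalAngle (T.place k) ∧
        cornerAngle (N.curve e).drawn (T.cyclicDrawn (T.place k)) =
          startAngle T.cyclicDrawn (T.place k) - α e := by
  by_cases hv : ∃ k : N.K, k = v
  · obtain ⟨k, rfl⟩ := hv
    refine ⟨fun e => startAngle T.cyclicDrawn (T.place k) -
        cornerAngle (N.curve e).drawn (T.cyclicDrawn (T.place k)),
      fun e => T.arrivalAngle (T.place k) +
        cornerAngle (T.cyclicDrawn (T.place k + (T.len - 1))) (N.curve e).drawn,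
      fun e => coe_sub_arg_div (lastVel_ne_zero _) (headVel_ne_zero _) (coe_startAngle _ _),
      fun e => coe_add_arg_div (lastVel_ne_zero _) (headVel_ne_zero _) (T.coe_arrivalAngle _),
      fun e f he hf => ?_, fun k' hk' e => ?_⟩
    · exact absurd (hf ▸ k.2) (hN.src_notMem_K e f (he.trans hf.symm))
    · obtain rfl := Subtype.ext hk'
      simp
  · obtain ⟨α, β, hα, hβ, hαβ⟩ := exists_arg_div_eq_sub
      (fun e => lastVel_ne_zero (N.curve e).drawn) (fun e => headVel_ne_zero (N.curve e).drawn)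
      (hN.subsingleton_or v fun h => hv ⟨⟨v, h⟩, rfl⟩)
    exact ⟨α, β, hα, hβ, fun e f he hf => hαβ e he f hf, fun k hk => absurd ⟨k, hk⟩ hv⟩

theorem nonempty_tangentAngles (hN : N.IsPerfect) : Nonempty T.TangentAngles := by
  choose α β hα hβ hcorner hboundary using T.exists_vertex_angles hN
  have hturns (e : E) : ∃ n : ℤ, pathTurning (N.curve e).drawn =
      α (N.tgt e) e - β (N.src e) e + 2 * Real.pi * n := by
    obtain ⟨n, hn⟩ := Real.Angle.angle_eq_iff_two_pi_dvd_sub.mp <|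
      show (pathTurning (N.curve e).drawn : Real.Angle) =
          ((α (N.tgt e) e - β (N.src e) e : ℝ) : Real.Angle) by
        rw [coe_pathTurning, Real.Angle.coe_sub, hα, hβ]
    exact ⟨n, by linarith⟩
  choose turns hturns using hturns
  exact ⟨{
    start := fun e => β (N.src e) e
    finish := fun e => α (N.tgt e) e
    turns := turns
    pathTurning_drawn := hturns
    cornerAngle_drawn := fun e f h => by rw [hcorner (N.tgt e) e f rfl h.symm, h]
    cornerAngle_source := fun i e h => by rw [(hboundary _ i h.symm e).1]
    cornerAngle_sink := fun j e h => by rw [(hboundary _ j h.symm e).2] }⟩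

end CutSurface

/-! ### Rotation numbers of the closed curves -/

namespace CutSurface

variable {D : PuncturedPolygon} {V E : Type*} {N : Network D V E} (T : CutSurface N)

theorem exists_boundaryFromTo_eq (i j : N.K) : ∃ n,
    T.boundaryFromTo j i = ((List.range (n + 1)).flatMap fun m => T.cyclicDrawn (T.place j + m)) ∧
      (T.place j : ℕ) + n + 1 = T.place i + if T.place j < T.place i then 0 else T.len := by
  have hi := (T.place i).2
  have hj := (T.place j).2
  suffices ∃ n, (if ((T.place i : ℕ) + T.len - T.place j) % T.len = 0 then T.len
      else ((T.place i : ℕ) + T.len - T.place j) % T.len) = n + 1 ∧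
      (T.place j : ℕ) + n + 1 = T.place i + if T.place j < T.place i then 0 else T.len by
    obtain ⟨n, hn, hplace⟩ := this
    exact ⟨n, by rw [← hn]; rfl, hplace⟩
  simp only [Fin.lt_def]
  rcases lt_trichotomy (T.place j : ℕ) (T.place i) with h | h | h
  · refine ⟨T.place i - T.place j - 1, ?_⟩
    rw [Nat.mod_eq_sub_mod (by omega), Nat.mod_eq_of_lt (by omega), if_neg (by omega), if_pos h]
    omega
  · refine ⟨T.len - 1, ?_⟩
    rw [h, Nat.add_sub_cancel_left, Nat.mod_self, if_pos rfl, if_neg (lt_irrefl _)]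
    omega
  · refine ⟨T.place i + T.len - T.place j - 1, ?_⟩
    rw [Nat.mod_eq_of_lt (by omega), if_neg (by omega), if_neg h.not_gt]
    omega

theorem boundaryFromTo_ne_nil (i j : N.K) : T.boundaryFromTo j i ≠ [] := by
  obtain ⟨n, hn, -⟩ := T.exists_boundaryFromTo_eq i j
  exact hn ▸ flatMap_ne_nil (fun _ => T.cyclicDrawn_ne_nil _) (by simp)

theorem headVel_boundaryFromTo (i j : N.K) :
    headVel (T.boundaryFromTo j i) = headVel (T.cyclicDrawn (T.place j)) := by
  obtain ⟨n, hn, -⟩ := T.exists_boundaryFromTo_eq i j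
  rw [hn, headVel_flatMap (fun _ => T.cyclicDrawn_ne_nil _) (by simp)]
  simp

theorem cyclicDrawn_pred {m n : ℕ} {p : Prop} [Decidable p]
    (h : n + 1 = m + if p then 0 else T.len) :
    T.cyclicDrawn n = T.cyclicDrawn (m + (T.len - 1)) := by
  have hlen := T.len_pos
  split_ifs at h
  · rw [← T.cyclicDrawn_periodic n, show n + T.len = m + (T.len - 1) by omega]
  · rw [show n = m + (T.len - 1) by omega]

theorem lastVel_boundaryFromTo (i j : N.K) : lastVel (T.boundaryFromTo j i) =
    lastVel (T.cyclicDrawn (T.place i + (T.len - 1))) := by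
  obtain ⟨n, hn, hplace⟩ := T.exists_boundaryFromTo_eq i j
  rw [hn, lastVel_flatMap (fun _ => T.cyclicDrawn_ne_nil _) (by simp), ← T.cyclicDrawn_pred hplace]
  simp

theorem pathTurning_boundaryFromTo (i j : N.K) : pathTurning (T.boundaryFromTo j i) =
    T.arrivalAngle (T.place i) - startAngle T.cyclicDrawn (T.place j) +
      if T.place j < T.place i then 0
      else startAngle T.cyclicDrawn T.len - startAngle T.cyclicDrawn 0 := by
  obtain ⟨n, hn, hplace⟩ := T.exists_boundaryFromTo_eq i j
  rw [hn, pathTurning_flatMap_range T.cyclicDrawn_ne_nil, T.cyclicDrawn_pred hplace, hplace,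
    arrivalAngle]
  split_ifs
  · simp only [add_zero]
  · rw [startAngle_add_period T.cyclicDrawn_periodic, T.cyclicDrawn_periodic]
    ring

theorem two_pi_mul_rotationNumber_closedCurve {i j : N.K} (P : N.Path i j) :
    2 * Real.pi * rotationNumber (T.closedCurve i j P) =
      pathTurning (T.closedCurve i j P) + cornerAngle (T.closedCurve i j P) (T.closedCurve i j P) :=
  two_pi_mul_rotationNumber (by simp [closedCurve, T.boundaryFromTo_ne_nil])

theorem rotationNumber_closedCurve_nil {i j : N.K} {P : N.Path i j} (hP : P.1 = []) {R : ℤ}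
    (hR : startAngle T.cyclicDrawn T.len - startAngle T.cyclicDrawn 0 = 2 * Real.pi * R) :
    rotationNumber (T.closedCurve i j P) = R := by
  obtain rfl : i = j := Subtype.ext (show N.IsPath i [] j from hP ▸ P.2)
  have hcorner : cornerAngle (T.boundaryFromTo i i) (T.boundaryFromTo i i) =
      cornerAngle (T.cyclicDrawn (T.place i + (T.len - 1))) (T.cyclicDrawn (T.place i)) := by
    rw [cornerAngle, headVel_boundaryFromTo, lastVel_boundaryFromTo, cornerAngle]
  have hrot := T.two_pi_mul_rotationNumber_closedCurve P
  rw [closedCurve, hP, List.flatMap_nil, List.nil_append, hcorner, pathTurning_boundaryFromTo,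
    if_neg (lt_irrefl _), arrivalAngle, hR] at hrot
  have : 2 * Real.pi * rotationNumber (T.boundaryFromTo i i) = 2 * Real.pi * R := by linarith
  rw [closedCurve, hP, List.flatMap_nil, List.nil_append]
  exact_mod_cast mul_left_cancel₀ Real.two_pi_pos.ne' this

variable {T}

theorem TangentAngles.pathTurning_flatMap_drawn (A : T.TangentAngles) {i j : V} {P : List E}
    (hP : N.IsPath i P j) (hne : P ≠ []) :
    pathTurning (P.flatMap fun e => (N.curve e).drawn) =
      A.finish (P.getLast hne) - A.start (P.head hne) + 2 * Real.pi * (P.map A.turns).sum := by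
  rw [pathTurning_flatMap (fun _ => Curve.drawn_ne_nil _) A.pathTurning_drawn hne
    (hP.isChain.imp A.cornerAngle_drawn)]
  congr 1
  push_cast [List.sum_map_mul_left, Function.comp_def, List.map_map]
  rfl

theorem TangentAngles.rotationNumber_closedCurve (A : T.TangentAngles) {i j : N.K}
    {P : N.Path i j} (hne : P.1 ≠ []) {R : ℤ}
    (hR : startAngle T.cyclicDrawn T.len - startAngle T.cyclicDrawn 0 = 2 * Real.pi * R) :
    rotationNumber (T.closedCurve i j P) =
      (P.1.map A.turns).sum + if T.place j < T.place i then 0 else R := by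
  have hdrawn (e : E) : (N.curve e).drawn ≠ [] := Curve.drawn_ne_nil _
  have hpath : (P.1.flatMap fun e => (N.curve e).drawn) ≠ [] := flatMap_ne_nil hdrawn hne
  have hboundary := T.boundaryFromTo_ne_nil i j
  have hsource : cornerAngle (T.closedCurve i j P) (T.closedCurve i j P) =
      A.start (P.1.head hne) - T.arrivalAngle (T.place i) := by
    rw [← A.cornerAngle_source i _ (P.2.src_head hne), cornerAngle, closedCurve,
      headVel_append hpath, lastVel_append _ hboundary, headVel_flatMap hdrawn hne,
      lastVel_boundaryFromTo, cornerAngle]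
  have hsink : cornerAngle (P.1.flatMap fun e => (N.curve e).drawn) (T.boundaryFromTo j i) =
      startAngle T.cyclicDrawn (T.place j) - A.finish (P.1.getLast hne) := by
    rw [← A.cornerAngle_sink j _ (P.2.tgt_getLast hne), cornerAngle, headVel_boundaryFromTo,
      lastVel_flatMap hdrawn hne, cornerAngle]
  have hrot := T.two_pi_mul_rotationNumber_closedCurve P
  rw [hsource, closedCurve, pathTurning_append hpath hboundary, hsink,
    A.pathTurning_flatMap_drawn P.2 hne, pathTurning_boundaryFromTo, hR] at hrot
  refine Int.cast_injective (α := ℝ) (mul_left_cancel₀ Real.two_pi_pos.ne' ?_)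
  rw [closedCurve, hrot]
  split_ifs <;> push_cast <;> ring

end CutSurface

/-! ### Signs -/

theorem ncard_inter_Iio_eq_add {α : Type*} [LinearOrder α] [Finite α] (S : Set α) {a b : α}
    (hab : a < b) :
    (S ∩ Iio b).ncard = (S ∩ Iio a).ncard + (S ∩ {a}).ncard + (S ∩ Ioo a b).ncard := by
  rw [← Iic_union_Ioo_eq_Iio hab, ← Iio_union_right, inter_union_distrib_left,
    inter_union_distrib_left, Set.ncard_union_eq, Set.ncard_union_eq]
  · exact Set.disjoint_left.mpr fun x hx hx' => hx.2.ne hx'.2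
  · rw [← inter_union_distrib_left, Iio_union_right]
    exact Set.disjoint_left.mpr fun x hx hx' => hx.2.not_gt hx'.2.1

theorem negOnePow_list_sum (l : List ℤ) : l.sum.negOnePow = (l.map Int.negOnePow).prod := by
  induction l with
  | nil => rfl
  | cons n l ih => rw [List.sum_cons, Int.negOnePow_add, ih, List.map_cons, List.prod_cons]

namespace CutSurface

variable {D : PuncturedPolygon} {V E : Type*} {N : Network D V E} (T : CutSurface N)

theorem place_injective : Function.Injective T.place := fun v w h =>
  Subtype.ext (N.pos_injective (by rw [← T.place_start v, h, T.place_start w]))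

/-- The places of the boundary sources in the linear order of the boundary vertices. -/
def sourcePlaces : Set (Fin T.len) := T.place '' {k | k.1 ∈ N.I}

theorem place_mem_sourcePlaces {k : N.K} : T.place k ∈ T.sourcePlaces ↔ k.1 ∈ N.I :=
  T.place_injective.mem_set_image

theorem between_eq_ncard (i j : N.K) : T.between i j = (T.sourcePlaces ∩
    (Ioo (T.place i) (T.place j) ∪ Ioo (T.place j) (T.place i))).ncard := by
  rw [sourcePlaces, ← Set.image_inter_preimage, Set.ncard_image_of_injective _ T.place_injective]
  rfl

theorem between_comm (i j : N.K) : T.between i j = T.between j i := by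
  rw [between_eq_ncard, between_eq_ncard, union_comm]

theorem between_of_le {i j : N.K} (h : T.place i ≤ T.place j) :
    T.between i j = (T.sourcePlaces ∩ Ioo (T.place i) (T.place j)).ncard := by
  rw [between_eq_ncard, Ioo_eq_empty h.not_gt, union_empty]

theorem between_self (i : N.K) : T.between i i = 0 := by
  rw [T.between_of_le le_rfl, Ioo_self, inter_empty, Set.ncard_empty]

/-- The parity of the number of boundary sources before a boundary vertex. -/
noncomputable def sourceSign (v : N.K) : ℤˣ :=
  Int.negOnePow (T.sourcePlaces ∩ Iio (T.place v)).ncard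

theorem negOnePow_between {i j : N.K} (hi : i.1 ∈ N.I) (hj : j.1 ∉ N.I) :
    Int.negOnePow (T.between i j) * (if T.place j < T.place i then 1 else -1) =
      T.sourceSign i * T.sourceSign j := by
  have hne : T.place i ≠ T.place j := fun h => hj (T.place_injective h ▸ hi)
  rcases hne.lt_or_gt with h | h
  · have hi' : T.sourcePlaces ∩ {T.place i} = {T.place i} :=
      inter_eq_right.mpr (singleton_subset_iff.mpr (T.place_mem_sourcePlaces.mpr hi))
    rw [if_neg h.not_gt, T.between_of_le h.le, sourceSign, sourceSign,
      ncard_inter_Iio_eq_add _ h, hi', Set.ncard_singleton]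
    push_cast
    rw [Int.negOnePow_add, Int.negOnePow_add, Int.negOnePow_one, ← mul_assoc, ← mul_assoc,
      Int.units_mul_self, one_mul, mul_comm]
  · have hj' : T.sourcePlaces ∩ {T.place j} = ∅ :=
      inter_singleton_eq_empty.mpr fun hj' => hj (T.place_mem_sourcePlaces.mp hj')
    rw [if_pos h, T.between_comm, T.between_of_le h.le, sourceSign, sourceSign,
      ncard_inter_Iio_eq_add _ h, hj', Set.ncard_empty]
    push_cast
    rw [add_zero, Int.negOnePow_add, mul_right_comm, Int.units_mul_self, mul_comm]

variable {T} in
theorem TangentAngles.negOnePow_rotationNumber (A : T.TangentAngles) {i j : N.K} {P : N.Path i j}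
    (hne : P.1 ≠ []) : (rotationNumber (T.closedCurve i j P)).negOnePow =
      (P.1.map fun e => (A.turns e).negOnePow).prod *
        if T.place j < T.place i then 1 else -1 := by
  obtain ⟨R, hodd, hR⟩ := T.exists_odd_startAngle_len_sub
  rw [A.rotationNumber_closedCurve hne hR, Int.negOnePow_add, negOnePow_list_sum, List.map_map]
  congr 1
  split_ifs
  · rfl
  · exact Int.negOnePow_odd R hodd

theorem exists_edge_signs (hN : N.IsPerfect) : ∃ ε : E → ℤˣ,
    ∀ (i j : N.K) (P : N.Path i j), i.1 ∈ N.I →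
      Int.negOnePow (T.between i j + rotationNumber (T.closedCurve i j P) + 1) =
        (P.1.map ε).prod := by
  obtain ⟨A⟩ := T.nonempty_tangentAngles hN
  let a : V → ℤˣ := Function.extend Subtype.val (fun v => -T.sourceSign v) 1
  let b : V → ℤˣ := Function.extend Subtype.val T.sourceSign 1
  refine ⟨fun e => (A.turns e).negOnePow * a (N.src e) * b (N.tgt e), fun i j P hi => ?_⟩
  rcases eq_or_ne P.1 [] with hP | hP
  · obtain rfl : i = j := Subtype.ext (show N.IsPath i [] j from hP ▸ P.2)
    obtain ⟨R, hodd, hR⟩ := T.exists_odd_startAngle_len_sub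
    rw [T.rotationNumber_closedCurve_nil hP hR, T.between_self, hP, Nat.cast_zero, zero_add,
      Int.negOnePow_even _ hodd.add_one, List.map_nil, List.prod_nil]
  · have hab : ∀ e f, N.tgt e = N.src f → b (N.tgt e) * a (N.src f) = 1 := fun e f h => by
      have hf : ¬ ∃ k : N.K, k = N.src f := fun ⟨k, hk⟩ => hN.src_notMem_K e f h (hk ▸ k.2)
      simp only [a, b, h, Function.extend_apply' _ _ _ hf, Pi.one_apply, mul_one]
    have hj : j.1 ∉ N.I := fun hj => hj.2 _ (P.2.tgt_getLast hP)
    have ha : a i = -T.sourceSign i := Subtype.val_injective.extend_apply _ _ _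
    have hb : b j = T.sourceSign j := Subtype.val_injective.extend_apply _ _ _
    rw [P.2.prod_map_mul hab _ hP, ha, hb, mul_assoc, neg_mul, ← T.negOnePow_between hi hj,
      Int.negOnePow_succ, Int.negOnePow_add, A.negOnePow_rotationNumber hP, mul_neg,
      mul_left_comm]

end CutSurface

theorem mainTheorem2_general {V E : Type*} (D : PuncturedPolygon) (N : Network D V E)
    (hN : N.IsPerfect) (T : CutSurface N) :
    ∃ ε : E → ℝ, (∀ e, ε e = 1 ∨ ε e = -1) ∧
      T.B (fun e => MvPowerSeries.X e) =
        N.A (fun e => MvPowerSeries.C (ε e) * MvPowerSeries.X e) := by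
  obtain ⟨ε, hε⟩ := T.exists_edge_signs hN
  refine ⟨fun e => ((ε e : ℤ) : ℝ), fun e => ?_, ?_⟩
  · rcases Int.units_eq_one_or (ε e) with h | h <;> simp [h]
  · ext1 i j
    refine tsum_congr fun P => ?_
    have hsign : (-1 : ℝ) ^ ((T.between ⟨i, i.2.1⟩ j : ℤ) +
        rotationNumber (T.closedCurve ⟨i, i.2.1⟩ j P) + 1) =
          (P.1.map fun e => ((ε e : ℤ) : ℝ)).prod := by
      rw [← Int.cast_negOnePow, hε ⟨i, i.2.1⟩ j P i.2]
      exact (map_list_prod ((Int.castRingHom ℝ : ℤ →* ℝ).comp (Units.coeHom ℤ)) _).trans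
        (by rw [List.map_map]; rfl)
    rw [P.wt_C_mul, hsign]

theorem mainTheorem2 {V E : Type*} [Finite V] [Finite E] (D : PuncturedPolygon)
    (N : Network D V E) (hN : N.PerfectlyOriented) (T : CutSurface N) :
    ∃ ε : E → ℝ, (∀ e, ε e = 1 ∨ ε e = -1) ∧
      T.B (fun e => MvPowerSeries.X e) =
        N.A (fun e => MvPowerSeries.C (ε e) * MvPowerSeries.X e) :=
  mainTheorem2_general D N hN.isPerfect T
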